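/- **Theorem 3.1.** Let $f:\mathbb R\to\mathbb C$ be $2\pi$-periodic and piecewise analytic: an interval of length $2\pi$ can be cut into finitely many subintervals such that on the interior of each one $f$ coincides with a function real-analytic in a neighbourhood of the closed subinterval. Let $\operatorname{sing\,supp} f$ be the complement of the largest open set on which $f$ is $C^\infty$, assumed non-empty, let $d(x)=\operatorname{dist}(x,\operatorname{sing\,supp} f)$ and $\theta=\theta(x)=d(x)/\pi$. Let $$S_Nf(x)=\sum_{|k|\le N}\hat f_k e^{ikx},\qquad \hat f_k=\frac1{2\pi}\int_{-\pi}^{\pi}f(x)e^{-ikx}\,dx .$$ For $c>0$ put $\rho_c(x)=\exp\!\big(\tfrac{cx^2}{x^2-\pi^2}\big)$ if $|x|<\pi$ and $\rho_c(x)=0$ otherwise, $D_p(x)=\frac1{2\pi}\sum_{|k|\le p}e^{ikx}$, and $\psi_{p,\theta}(x)=\frac1\theta\rho_c\big(\frac x\theta\big)D_p\big(\frac x\theta\big)$. Let $\beta>1$ with $\kappa:=\beta\log\beta<1$ (in particular $\beta<1.764$). (a) For given $c,\beta,f$ there are $\eta,\varepsilon>0$ such that for all $\delta>0$ and $B\in\mathbb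 R$ there is $C>0$ with $$|\psi_{p,\theta}\star S_Nf(x)-f(x)|\le C\,\theta N\Big(\frac{\beta}{e}\Big)^{2\sqrt{\kappa\eta\,\theta N}}$$ for all $x\in\mathbb R$ and all integers $N,p\ge0$ such that $\theta N\ge\delta$ and $|p-\kappa\theta N|\le\varepsilon\theta N+B$. (The last condition covers every choice $p=\kappa\theta N+O(1)$, and, up to finitely many $N$, every choice with $p/(\kappa\theta N)\to1$.) So the recovery is exponentially accurate, with constants uniform in $x$, except within distance $O(1/N)$ of the singularities of $f$. (b) The constants depend on $f$ as follows. For given $c,\beta$ and every $r>0$ there are $\eta,\varepsilon>0$ such that for all $\delta>0$ and $B\in\mathbb R$ there is $C>0$ with the following property. Let $f$ be any function as above, and let $x,K\in\mathbb R$ be such that $|f^{(s)}(y)|\le K\,s!\,r^{-s}$ whenever $|y-x|<d(x)$ and $s\ge0$. Let $V$ be the total variation of $f$ on $[0,2\pi]$. Then $$|\psi_{p,\theta}\star S_Nf(x)-f(x)|\le C\,(K+V)\,\theta N\Big(\frac{\beta}{e}\Big)^{2\sqrt{\kappa\eta\,\theta N}}$$ for all integers $N,p\ge0$ such that $\theta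 N\ge\delta$ and $|p-\kappa\theta N|\le\varepsilon\theta N+B$. -/

import Mathlib

open scoped ContDiff Convolution

noncomputable section

namespace SpectralMollifier

/-- Piecewise analyticity of a `2π`-periodic function: some interval of length one period is cut
into finitely many subintervals, and on the interior of each of them `f` coincides with a function
which is real-analytic in a neighbourhood of the closed subinterval (so `f` is analytic up to the
break points from either side; the values at the break points are arbitrary). -/
def IsPiecewiseAnalytic (f : ℝ → ℂ) : Prop :=
  ∃ (n : ℕ) (t : ℕ → ℝ), (∀ i < n, t i < t (i + 1)) ∧ t n = t 0 + 2 * Real.pi ∧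
    ∀ i < n, ∃ g : ℝ → ℂ, AnalyticOnNhd ℝ g (Set.Icc (t i) (t (i + 1))) ∧
      Set.EqOn f g (Set.Ioo (t i) (t (i + 1)))

/-- The singular support: the complement of the largest open set on which `f` is `C^∞`. -/
def singSupp (f : ℝ → ℂ) : Set ℝ :=
  {x | ¬ ∃ U : Set ℝ, IsOpen U ∧ x ∈ U ∧ ContDiffOn ℝ ∞ f U}

/-- The dilation parameter `θ(x) = d(x) / π`, where `d(x) = dist (x, sing supp f)`. -/
def theta (f : ℝ → ℂ) (x : ℝ) : ℝ :=
  Metric.infDist x (singSupp f) / Real.pi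

/-- The Fourier coefficient `(1 / 2π) ∫_{-π}^{π} f(x) e^{-ikx} dx`. -/
def fourierCoef (f : ℝ → ℂ) (k : ℤ) : ℂ :=
  1 / (2 * Real.pi) * ∫ x in (-Real.pi)..Real.pi, f x * Complex.exp (-(Complex.I * k * x))

/-- The Fourier projection `S_N f`. -/
def fourierProj (N : ℕ) (f : ℝ → ℂ) (x : ℝ) : ℂ :=
  ∑ k ∈ Finset.Icc (-(N : ℤ)) N, fourierCoef f k * Complex.exp (Complex.I * k * x)

/-- The Dirichlet kernel `D_p(x) = (1 / 2π) ∑_{|k| ≤ p} e^{ikx}`. -/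
def dirichletKernel (p : ℕ) (x : ℝ) : ℂ :=
  1 / (2 * Real.pi) * ∑ k ∈ Finset.Icc (-(p : ℤ)) p, Complex.exp (Complex.I * k * x)

/-- The cut-off function `ρ_c`. -/
def cutoff (c x : ℝ) : ℝ :=
  if |x| < Real.pi then Real.exp (c * x ^ 2 / (x ^ 2 - Real.pi ^ 2)) else 0

/-- The mollifier `ψ_{p,θ}(x) = θ⁻¹ ρ_c(x / θ) D_p(x / θ)`. -/
def mollifier (c : ℝ) (p : ℕ) (θ x : ℝ) : ℂ :=
  (1 / θ : ℝ) * (cutoff c (x / θ) : ℂ) * dirichletKernel p (x / θ)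

/-- The recovered value `(ψ_{p,θ} ⋆ S_N f)(x)`; since `ψ_{p,θ}` is supported in `[-πθ, πθ]`, the
convolution is the one on the real line. -/
def recovered (c : ℝ) (p : ℕ) (θ : ℝ) (N : ℕ) (f : ℝ → ℂ) (x : ℝ) : ℂ :=
  (mollifier c p θ ⋆[ContinuousLinearMap.mul ℝ ℂ, MeasureTheory.volume] fourierProj N f) x

end SpectralMollifier

end

open SpectralMollifier

/-! The error is split at `ψ ⋆ f`. After rescaling by `θ`, `ψ ⋆ f (x)` is the integral of `D_p`
against `G(u) = ρ_c(u) f(x - θu)`, i.e. the `p`-th Fourier partial sum of `G` at `0`, while `G(0) =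
f(x)`. So the regularization error `ψ ⋆ f - f` is a Fourier tail of `G`. Dilation by `θ = d(x)/π`
makes `f(x - θu)` smooth with Cauchy bounds on `|u| < π`, and `ρ_c` is flat at `±π` and Gevrey of
order 2, so `G` is too: its `n`-th derivative is at most `const * q^n * n!^2`. Integrating by parts
`n` times and summing over `n` gives coefficients `O(exp(-a√|j|))`
(`exists_norm_integral_cutoff_mul_le`), hence an error `O(exp(-a'√p))`
(`exists_norm_regularization_le`).

The truncation error `ψ ⋆ (S_N f - f)` is the sum over `|k| > N` of `f̂_k e^{ikx}` times the Fourier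
transform `symbol` of `ρ_c D_p` at `kθ`. Here `f̂_k = O(V/|k|)` by bounded variation, and the symbol
is a sum of `2p+1` transforms of `ρ_c` at frequencies of size at least `|k|θ - p`, so it decays like
`exp(-a√(|k|θ - p))` (`exists_norm_truncation_le`).

With `p ≈ κθN` and `0 < κ < 1`, both `p` and the gap `θN - p` are comparable to `θN`, and both
errors are `exp(-a√(θN))` up to factors controlled by `θN ≥ δ`. Since `log β < 1`, this exponential
is a power of `β/e` for a suitable `η`. Part (a) follows from (b), because a piecewise analytic `f`
satisfies one Cauchy bound on the whole complement of its singular support. -/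

/-! ### Gevrey bounds for `exp(-1/x)` -/

/-- `expNegInvGlueJet s m` is the `s`-th derivative of `x ↦ x⁻¹ ^ m * expNegInvGlue x`. -/
noncomputable def expNegInvGlueJet : ℕ → ℕ → ℝ → ℝ
  | 0, m => fun x => x⁻¹ ^ m * expNegInvGlue x
  | s + 1, m => fun x => expNegInvGlueJet s (m + 2) x - m * expNegInvGlueJet s (m + 1) x

theorem hasDerivAt_expNegInvGlueJet (s m : ℕ) (x : ℝ) :
    HasDerivAt (expNegInvGlueJet s m) (expNegInvGlueJet (s + 1) m x) x := by
  induction s generalizing m with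
  | zero =>
    have h := expNegInvGlue.hasDerivAt_polynomial_eval_inv_mul (Polynomial.X ^ m) x
    simp only [Polynomial.eval_pow, Polynomial.eval_X] at h
    refine HasDerivAt.congr_deriv (f := expNegInvGlueJet 0 m) h ?_
    symm
    change expNegInvGlueJet 0 (m + 2) x - m * expNegInvGlueJet 0 (m + 1) x = _
    cases m with
    | zero => simp [expNegInvGlueJet]
    | succ m => simp [expNegInvGlueJet]; ring
  | succ s ih => exact (ih (m + 2)).sub ((ih (m + 1)).const_mul _)

theorem expNegInvGlueJet_of_nonpos (s m : ℕ) {x : ℝ} (hx : x ≤ 0) :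
    expNegInvGlueJet s m x = 0 := by
  induction s generalizing m with
  | zero => simp [expNegInvGlueJet, expNegInvGlue.zero_of_nonpos hx]
  | succ s ih => simp [expNegInvGlueJet, ih]

/-- For `s = 0` this is `y^m ≤ m! e^y` with `y = 1/x`. Each derivative produces two terms, and the
factor `m` of the second is absorbed by the factorial, so the bound at worst doubles while `m` grows
by 2. -/
theorem abs_expNegInvGlueJet_le (s m : ℕ) (x : ℝ) :
    |expNegInvGlueJet s m x| ≤ 2 ^ s * (m + 2 * s).factorial := by
  induction s generalizing m with
  | zero =>
    rcases le_or_gt x 0 with hx | hx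
    · rw [expNegInvGlueJet_of_nonpos _ _ hx, abs_zero]; positivity
    · have h1 := Real.pow_div_factorial_le_exp x⁻¹ (by positivity) m
      have h2 : (0 : ℝ) < m.factorial := by positivity
      rw [div_le_iff₀ h2] at h1
      simp only [expNegInvGlueJet, expNegInvGlue, not_le.2 hx, if_false]
      rw [abs_of_nonneg (by positivity), Real.exp_neg, ← div_eq_mul_inv,
        div_le_iff₀ (Real.exp_pos _)]
      simpa [mul_comm] using h1
  | succ s ih =>
    simp only [expNegInvGlueJet]
    have h1 := ih (m + 2)
    have h2 := ih (m + 1)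
    have h3 : |(m : ℝ) * expNegInvGlueJet s (m + 1) x|
        ≤ m * (2 ^ s * (m + 1 + 2 * s).factorial) := by
      rw [abs_mul, Nat.abs_cast]; gcongr
    have h4 : ((m + 2 + 2 * s).factorial : ℝ)
        = (m + 2 + 2 * s) * (m + 1 + 2 * s).factorial := by
      rw [show m + 2 + 2 * s = (m + 1 + 2 * s) + 1 by ring, Nat.factorial_succ]; push_cast; ring
    have h5 : (m : ℝ) * (m + 1 + 2 * s).factorial ≤ (m + 2 + 2 * s).factorial := by
      rw [h4]; gcongr; linarith
    rw [show m + 2 * (s + 1) = m + 2 + 2 * s by ring]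
    calc |expNegInvGlueJet s (m + 2) x - m * expNegInvGlueJet s (m + 1) x|
        ≤ |expNegInvGlueJet s (m + 2) x| + |m * expNegInvGlueJet s (m + 1) x| := by
          simpa only [Real.norm_eq_abs] using norm_sub_le (expNegInvGlueJet s (m + 2) x)
            (m * expNegInvGlueJet s (m + 1) x)
      _ ≤ 2 ^ s * (m + 2 + 2 * s).factorial + 2 ^ s * (m * (m + 1 + 2 * s).factorial) := by
        linarith
      _ ≤ 2 ^ s * (m + 2 + 2 * s).factorial + 2 ^ s * (m + 2 + 2 * s).factorial := by gcongr
      _ = _ := by ring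

theorem abs_expNegInvGlueJet_zero_le (s : ℕ) (x : ℝ) :
    |expNegInvGlueJet s 0 x| ≤ 8 ^ s * (s.factorial : ℝ) ^ 2 := by
  refine (abs_expNegInvGlueJet_le s 0 x).trans ?_
  have h : (2 * s).factorial ≤ 4 ^ s * (s.factorial) ^ 2 := by
    have h1 := Nat.centralBinom_eq_two_mul_choose s
    have h2 := Nat.choose_mul_factorial_mul_factorial (show s ≤ 2 * s by omega)
    have h3 : s.centralBinom ≤ 4 ^ s := by
      rw [h1]
      calc (2 * s).choose s ≤ 2 ^ (2 * s) := Nat.choose_le_two_pow _ _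
        _ = 4 ^ s := by rw [pow_mul]; norm_num
    rw [← h2, ← h1, show 2 * s - s = s by omega, mul_assoc, ← pow_two]
    gcongr
  have h' : ((2 * s).factorial : ℝ) ≤ 4 ^ s * (s.factorial : ℝ) ^ 2 := by exact_mod_cast h
  rw [zero_add, show (8 : ℝ) = 2 * 4 by norm_num, mul_pow, mul_assoc]
  gcongr

/-! ### Factorization of the cut-off -/

/-- Partial fractions: `c u²/(u² - π²) = c - (cπ/2) (1/(π - u) + 1/(π + u))`. Each endpoint gets its
own flat factor, to which the jet bounds apply. -/
theorem cutoff_eq_expNegInvGlue {c : ℝ} (hc : 0 < c) (u : ℝ) :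
    cutoff c u = Real.exp c * (expNegInvGlue (2 / (c * Real.pi) * (Real.pi - u)) *
      expNegInvGlue (2 / (c * Real.pi) * (Real.pi + u))) := by
  have hπ := Real.pi_pos
  have hα : 0 < 2 / (c * Real.pi) := by positivity
  unfold cutoff
  split_ifs with h
  · rw [abs_lt] at h
    have h1 : 0 < Real.pi - u := by linarith
    have h2 : 0 < Real.pi + u := by linarith
    have h3 : u ^ 2 - Real.pi ^ 2 ≠ 0 := by nlinarith
    simp only [expNegInvGlue, not_le.2 (mul_pos hα h1), not_le.2 (mul_pos hα h2), if_false]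
    rw [← Real.exp_add, ← Real.exp_add]
    congr 1
    rw [show u ^ 2 - Real.pi ^ 2 = -((Real.pi - u) * (Real.pi + u)) by ring]
    field_simp
    ring
  · rw [abs_lt, not_and_or, not_lt, not_lt] at h
    rcases h with h | h
    · rw [expNegInvGlue.zero_of_nonpos (x := 2 / (c * Real.pi) * (Real.pi + u))]
      · simp
      · exact mul_nonpos_of_nonneg_of_nonpos hα.le (by linarith)
    · rw [expNegInvGlue.zero_of_nonpos (x := 2 / (c * Real.pi) * (Real.pi - u))]
      · simp
      · exact mul_nonpos_of_nonneg_of_nonpos hα.le (by linarith)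

theorem continuous_cutoff {c : ℝ} (hc : 0 < c) : Continuous (cutoff c) := by
  have h : Continuous expNegInvGlue := (expNegInvGlue.contDiff (n := 0)).continuous
  rw [funext (cutoff_eq_expNegInvGlue hc)]
  fun_prop

theorem cutoff_zero (c : ℝ) : cutoff c 0 = 1 := by
  simp [cutoff, Real.pi_pos]

theorem cutoff_of_pi_le_abs (c : ℝ) {u : ℝ} (hu : Real.pi ≤ |u|) : cutoff c u = 0 := by
  simp [cutoff, not_lt.2 hu]

/-! ### Fourier decay by repeated integration by parts -/

/-- The three indices count the derivatives falling on the three factors of a product. Each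
integration by parts has no boundary term and replaces one integral by three, whence `3 ^ n`; a
bound depending only on the total order makes multinomial coefficients unnecessary. -/
theorem pow_mul_norm_integral_le (P : ℕ → ℕ → ℕ → ℝ → ℂ) (W : ℕ → ℝ)
    (hd : ∀ i j k u, HasDerivAt (P i j k) (P (i + 1) j k u + P i (j + 1) k u + P i j (k + 1) u) u)
    (h0 : ∀ i j k, P i j k (-Real.pi) = 0 ∧ P i j k Real.pi = 0)
    (hW : ∀ i j k u, ‖P i j k u‖ ≤ W (i + j + k)) (ξ : ℝ) (n i j k : ℕ) :
    |ξ| ^ n * ‖∫ u in (-Real.pi)..Real.pi, P i j k u * Complex.exp (-(Complex.I * ξ * u))‖ ≤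
      3 ^ n * (2 * Real.pi * W (i + j + k + n)) := by
  have hcont : ∀ i j k, Continuous (P i j k) := fun i j k =>
    continuous_iff_continuousAt.2 fun u => (hd i j k u).continuousAt
  induction n generalizing i j k with
  | zero =>
    have := intervalIntegral.norm_integral_le_of_norm_le_const (a := -Real.pi) (b := Real.pi)
      (C := W (i + j + k)) (f := fun u => P i j k u * Complex.exp (-(Complex.I * ξ * u))) ?_
    · rw [abs_of_nonneg (by linarith [Real.pi_pos])] at this
      simp only [pow_zero, one_mul, add_zero]
      linarith
    · intro u _
      rw [norm_mul, show -(Complex.I * ξ * u) = ((-(ξ * u) : ℝ) : ℂ) * Complex.I by push_cast; ring,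
        Complex.norm_exp_ofReal_mul_I, mul_one]
      exact hW i j k u
  | succ n ih =>
    set E : ℝ → ℂ := fun u => Complex.exp (-(Complex.I * ξ * u)) with hE
    have hEc : Continuous E := by fun_prop
    have hEd : ∀ u : ℝ, HasDerivAt E (E u * (-(Complex.I * ξ))) u := fun u => by
      have h1 : HasDerivAt (fun u : ℝ => -(Complex.I * ξ * (u : ℂ))) (-(Complex.I * ξ)) u := by
        have := ((Complex.ofRealCLM.hasDerivAt (x := u)).const_mul (Complex.I * ξ)).fun_neg
        simpa using this
      exact h1.cexp
    have hint := intervalIntegral.integral_eq_sub_of_hasDerivAt (a := -Real.pi) (b := Real.pi)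
      (fun u _ => (hd i j k u).mul (hEd u)) (Continuous.intervalIntegrable (by
        have := hcont i j k
        have := hcont (i + 1) j k
        have := hcont i (j + 1) k
        have := hcont i j (k + 1)
        fun_prop) _ _)
    have hsplit : ∫ u in (-Real.pi)..Real.pi,
        (P (i + 1) j k u + P i (j + 1) k u + P i j (k + 1) u) * E u
          + P i j k u * (E u * (-(Complex.I * ξ))) =
        (∫ u in (-Real.pi)..Real.pi, P (i + 1) j k u * E u) +
        (∫ u in (-Real.pi)..Real.pi, P i (j + 1) k u * E u) +
        (∫ u in (-Real.pi)..Real.pi, P i j (k + 1) u * E u) +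
        (-(Complex.I * ξ)) * ∫ u in (-Real.pi)..Real.pi, P i j k u * E u := by
      have hi : ∀ i j k, IntervalIntegrable (fun u => P i j k u * E u) MeasureTheory.volume
          (-Real.pi) Real.pi := fun i j k => ((hcont i j k).mul hEc).intervalIntegrable _ _
      rw [← intervalIntegral.integral_const_mul, ← intervalIntegral.integral_add (hi _ _ _)
        (hi _ _ _), ← intervalIntegral.integral_add ((hi _ _ _).add (hi _ _ _)) (hi _ _ _),
        ← intervalIntegral.integral_add (((hi _ _ _).add (hi _ _ _)).add (hi _ _ _))
        ((hi _ _ _).const_mul _)]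
      congr 1 with u
      ring
    rw [hsplit] at hint
    simp only [Pi.mul_apply, (h0 i j k).1, (h0 i j k).2, zero_mul, sub_zero] at hint
    have hnorm : |ξ| * ‖∫ u in (-Real.pi)..Real.pi, P i j k u * E u‖ ≤
        ‖∫ u in (-Real.pi)..Real.pi, P (i + 1) j k u * E u‖ +
        ‖∫ u in (-Real.pi)..Real.pi, P i (j + 1) k u * E u‖ +
        ‖∫ u in (-Real.pi)..Real.pi, P i j (k + 1) u * E u‖ := by
      have h1 : (Complex.I * ξ) * (∫ u in (-Real.pi)..Real.pi, P i j k u * E u) =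
        (∫ u in (-Real.pi)..Real.pi, P (i + 1) j k u * E u) +
        (∫ u in (-Real.pi)..Real.pi, P i (j + 1) k u * E u) +
        (∫ u in (-Real.pi)..Real.pi, P i j (k + 1) u * E u) := by
        linear_combination -hint
      have h2 := congrArg norm h1
      rw [norm_mul, norm_mul, Complex.norm_I, one_mul, Complex.norm_real, Real.norm_eq_abs] at h2
      rw [h2]
      exact norm_add₃_le
    have i1 := ih (i + 1) j k
    have i2 := ih i (j + 1) k
    have i3 := ih i j (k + 1)
    rw [show i + 1 + j + k + n = i + j + k + (n + 1) by ring] at i1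
    rw [show i + (j + 1) + k + n = i + j + k + (n + 1) by ring] at i2
    rw [show i + j + (k + 1) + n = i + j + k + (n + 1) by ring] at i3
    have := mul_le_mul_of_nonneg_left hnorm (pow_nonneg (abs_nonneg ξ) n)
    rw [pow_succ, pow_succ, mul_assoc]
    linarith

/-- Bounds against squared factorials give stretched exponential decay. -/
theorem le_exp_neg_of_forall_pow_mul_le {A y C : ℝ} (hA : 0 ≤ A) (hC : 0 ≤ C)
    (h : ∀ n : ℕ, y ^ (2 * n) * A ≤ C * (n.factorial : ℝ) ^ 2) :
    A ≤ 4 * C * Real.exp (-y) := by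
  -- Square roots turn `n!^2` into `n!`; the weights `2^{-n}` then allow summation to `exp(y/2) √A ≤
  -- 2√C`, which is squared.
  have h1 : ∀ n : ℕ, (y / 2) ^ n / n.factorial * √A ≤ √C * (1 / 2) ^ n := fun n => by
    have h2 : y ^ n * √A ≤ √C * n.factorial := by
      apply le_of_sq_le_sq _ (by positivity)
      rw [mul_pow, mul_pow, Real.sq_sqrt hA, Real.sq_sqrt hC, ← pow_mul, mul_comm n]
      exact h n
    have h3 : (0 : ℝ) < n.factorial := by positivity
    rw [div_mul_eq_mul_div, div_le_iff₀ h3, div_pow, div_pow, one_pow]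
    calc y ^ n / 2 ^ n * √A = (y ^ n * √A) / 2 ^ n := by ring
      _ ≤ (√C * n.factorial) / 2 ^ n := by gcongr
      _ = _ := by ring
  have h2 : Real.exp (y / 2) * √A ≤ √C * 2 := by
    have e1 : HasSum (fun n : ℕ => (y / 2) ^ n / n.factorial * √A) (Real.exp (y / 2) * √A) := by
      have := NormedSpace.expSeries_div_hasSum_exp (𝔸 := ℝ) (y / 2)
      rw [← Real.exp_eq_exp_ℝ] at this
      exact this.mul_right _
    have e2 : HasSum (fun n : ℕ => √C * (1 / 2 : ℝ) ^ n) (√C * 2) := hasSum_geometric_two.mul_left _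
    exact hasSum_le h1 e1 e2
  have h3 := pow_le_pow_left₀ (by positivity) h2 2
  rw [mul_pow, mul_pow, Real.sq_sqrt hA, Real.sq_sqrt hC, ← Real.exp_nat_mul] at h3
  have h4 : ((2 : ℕ) : ℝ) * (y / 2) = y := by push_cast; ring
  rw [h4] at h3
  rw [Real.exp_neg, ← div_eq_mul_inv, le_div_iff₀ (Real.exp_pos _)]
  linarith

/-- Used at `u = ±π`, where `h` may jump: `A` is `o(v - u)` there, and boundedness of `h` suffices.
-/
theorem hasDerivAt_mul_zero_of_bounded {A h : ℝ → ℂ} {u M : ℝ} (hA : HasDerivAt A 0 u)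
    (hA0 : A u = 0) (hh : ∀ v, ‖h v‖ ≤ M) : HasDerivAt (fun v => A v * h v) 0 u := by
  rw [hasDerivAt_iff_isLittleO] at hA ⊢
  simp only [hA0, zero_mul, sub_zero, smul_zero] at hA ⊢
  have hb : h =O[nhds u] (fun _ => (1 : ℝ)) :=
    Asymptotics.IsBigO.of_bound M (Filter.Eventually.of_forall fun v => by simpa using hh v)
  simpa using hA.mul_isBigO hb

/-- The Leibniz terms of the product of the two factors of the cut-off with the jet `h`. -/
noncomputable def cutoffMulJet (α : ℝ) (h : ℕ → ℝ → ℂ) (i j k : ℕ) (u : ℝ) : ℂ :=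
  ((((-α) ^ i * expNegInvGlueJet i 0 (α * (Real.pi - u))) *
    (α ^ j * expNegInvGlueJet j 0 (α * (Real.pi + u))) : ℝ) : ℂ) *
    if |u| < Real.pi then h k u else 0

theorem hasDerivAt_cutoffMulJet {α : ℝ} (hα : 0 < α) {h : ℕ → ℝ → ℂ} {M : ℕ → ℝ}
    (hd : ∀ k u, |u| < Real.pi → HasDerivAt (h k) (h (k + 1) u) u)
    (hM : ∀ k u, |u| < Real.pi → ‖h k u‖ ≤ M k) (i j k : ℕ) (u : ℝ) :
    HasDerivAt (cutoffMulJet α h i j k) (cutoffMulJet α h (i + 1) j k u +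
      cutoffMulJet α h i (j + 1) k u + cutoffMulJet α h i j (k + 1) u) u := by
  have hAd : HasDerivAt (fun u => (-α) ^ i * expNegInvGlueJet i 0 (α * (Real.pi - u)))
      ((-α) ^ (i + 1) * expNegInvGlueJet (i + 1) 0 (α * (Real.pi - u))) u := by
    have h1 : HasDerivAt (fun u => α * (Real.pi - u)) (α * -1) u :=
      ((hasDerivAt_id u).const_sub Real.pi).const_mul α
    refine HasDerivAt.congr_deriv
      (((hasDerivAt_expNegInvGlueJet i 0 _).comp u h1).const_mul ((-α) ^ i)) ?_
    ring
  have hBd : HasDerivAt (fun u => α ^ j * expNegInvGlueJet j 0 (α * (Real.pi + u)))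
      (α ^ (j + 1) * expNegInvGlueJet (j + 1) 0 (α * (Real.pi + u))) u := by
    have h1 : HasDerivAt (fun u => α * (Real.pi + u)) (α * 1) u :=
      ((hasDerivAt_id u).const_add Real.pi).const_mul α
    refine HasDerivAt.congr_deriv
      (((hasDerivAt_expNegInvGlueJet j 0 _).comp u h1).const_mul (α ^ j)) ?_
    ring
  have hAB := (hAd.fun_mul hBd).ofReal_comp
  by_cases hu : |u| < Real.pi
  · have hev : (fun v => if |v| < Real.pi then h k v else 0) =ᶠ[nhds u] h k := by
      filter_upwards [(isOpen_lt continuous_abs continuous_const).mem_nhds hu] with v hv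
      exact if_pos hv
    refine HasDerivAt.congr_deriv (f := cutoffMulJet α h i j k)
      (hAB.fun_mul ((hd k u hu).congr_of_eventuallyEq hev)) ?_
    simp only [cutoffMulJet, hu, if_true]
    push_cast
    ring
  -- Off the open interval one of the two flat factors vanishes with all its derivatives.
  · have hz : (∀ i, expNegInvGlueJet i 0 (α * (Real.pi - u)) = 0) ∨
        ∀ j, expNegInvGlueJet j 0 (α * (Real.pi + u)) = 0 := by
      rw [abs_lt, not_and_or, not_lt, not_lt] at hu
      rcases hu with hu | hu
      · exact .inr fun j => expNegInvGlueJet_of_nonpos _ _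
          (mul_nonpos_of_nonneg_of_nonpos hα.le (by linarith))
      · exact .inl fun j => expNegInvGlueJet_of_nonpos _ _
          (mul_nonpos_of_nonneg_of_nonpos hα.le (by linarith))
    have hM' : ∀ v, ‖if |v| < Real.pi then h k v else 0‖ ≤ |M k| := fun v => by
      split_ifs with hv
      · exact (hM k v hv).trans (le_abs_self _)
      · simp
    refine HasDerivAt.congr_deriv (f := cutoffMulJet α h i j k)
      (hasDerivAt_mul_zero_of_bounded (hAB.congr_deriv ?_) ?_ hM') ?_
    · rcases hz with hz | hz <;> simp [hz]
    · rcases hz with hz | hz <;> simp [hz]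
    · simp [cutoffMulJet, hu]

theorem norm_cutoffMulJet_le {α r K : ℝ} (hα : 0 < α) (hr : 0 < r) {h : ℕ → ℝ → ℂ}
    (hM : ∀ k u, |u| < Real.pi → ‖h k u‖ ≤ K * k.factorial / r ^ k) (i j k : ℕ) (u : ℝ) :
    ‖cutoffMulJet α h i j k u‖ ≤
      K * (8 * α + 1 / r) ^ (i + j + k) * ((i + j + k).factorial : ℝ) ^ 2 := by
  have hK : 0 ≤ K := by
    have := (norm_nonneg _).trans (hM 0 0 (by simp [Real.pi_pos]))
    simpa using this
  set q := 8 * α + 1 / r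
  have hq : 8 * α ≤ q := by have : 0 < 1 / r := by positivity
                            linarith
  have hq' : 1 / r ≤ q := by linarith
  have hq0 : 0 ≤ q := by positivity
  have key : ∀ (i : ℕ) (x : ℝ), α ^ i * |expNegInvGlueJet i 0 x| ≤
      q ^ i * (i.factorial : ℝ) ^ 2 := fun i x => by
    calc _ ≤ α ^ i * (8 ^ i * (i.factorial : ℝ) ^ 2) := by
          gcongr; exact abs_expNegInvGlueJet_zero_le i x
      _ = (8 * α) ^ i * (i.factorial : ℝ) ^ 2 := by rw [mul_pow]; ring
      _ ≤ _ := by gcongr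
  have key2 : ‖if |u| < Real.pi then h k u else 0‖ ≤ K * q ^ k * (k.factorial : ℝ) ^ 2 := by
    split_ifs with hu
    · have h1 : (1 : ℝ) ≤ k.factorial := by exact_mod_cast k.factorial_pos
      calc _ ≤ _ := hM k u hu
        _ = K * (1 / r) ^ k * k.factorial := by rw [one_div, inv_pow]; ring
        _ ≤ _ := by gcongr; nlinarith
    · rw [norm_zero]; positivity
  have hfac : ((i.factorial : ℝ) * j.factorial * k.factorial) ≤ (i + j + k).factorial := by
    have h1 := Nat.le_of_dvd (Nat.factorial_pos _) (Nat.factorial_mul_factorial_dvd_factorial_add i j)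
    have h2 := Nat.le_of_dvd (Nat.factorial_pos _)
      (Nat.factorial_mul_factorial_dvd_factorial_add (i + j) k)
    exact_mod_cast (Nat.mul_le_mul_right _ h1).trans h2
  unfold cutoffMulJet
  rw [norm_mul, Complex.norm_real, Real.norm_eq_abs, abs_mul, abs_mul, abs_mul, abs_pow, abs_pow,
    abs_neg, abs_of_pos hα]
  calc _ ≤ (q ^ i * (i.factorial : ℝ) ^ 2) * (q ^ j * (j.factorial : ℝ) ^ 2) *
        (K * q ^ k * (k.factorial : ℝ) ^ 2) := by
        exact mul_le_mul (mul_le_mul (key i _) (key j _) (by positivity) (by positivity)) key2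
          (norm_nonneg _) (by positivity)
    _ = K * q ^ (i + j + k) * (i.factorial * j.factorial * k.factorial : ℝ) ^ 2 := by
        rw [pow_add, pow_add]; ring
    _ ≤ _ := by gcongr

theorem cutoff_mul_eq_cutoffMulJet {c : ℝ} (hc : 0 < c) (h : ℕ → ℝ → ℂ) (u : ℝ) :
    (cutoff c u : ℂ) * h 0 u =
      Real.exp c * cutoffMulJet (2 / (c * Real.pi)) h 0 0 0 u := by
  by_cases hu : |u| < Real.pi
  · rw [cutoff_eq_expNegInvGlue hc]
    simp [cutoffMulJet, hu, expNegInvGlueJet]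
    ring
  · simp [cutoff, cutoffMulJet, hu]

theorem continuous_cutoff_mul {c r K : ℝ} (hc : 0 < c) {h : ℕ → ℝ → ℂ}
    (hd : ∀ k u, |u| < Real.pi → HasDerivAt (h k) (h (k + 1) u) u)
    (hM : ∀ k u, |u| < Real.pi → ‖h k u‖ ≤ K * k.factorial / r ^ k) :
    Continuous fun u => (cutoff c u : ℂ) * h 0 u := by
  have hα : 0 < 2 / (c * Real.pi) := by have := Real.pi_pos; positivity
  simp_rw [cutoff_mul_eq_cutoffMulJet hc]
  exact continuous_const.mul (continuous_iff_continuousAt.2 fun u =>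
    (hasDerivAt_cutoffMulJet hα hd hM 0 0 0 u).continuousAt)

/-- The Fourier transform of the cut-off times a function which is analytic with radius `r`
decays like `exp (-a √|ξ|)`. -/
theorem exists_norm_integral_cutoff_mul_le {c r : ℝ} (hc : 0 < c) (hr : 0 < r) :
    ∃ a > 0, ∃ C > 0, ∀ (h : ℕ → ℝ → ℂ) (K : ℝ),
      (∀ k u, |u| < Real.pi → HasDerivAt (h k) (h (k + 1) u) u) →
      (∀ k u, |u| < Real.pi → ‖h k u‖ ≤ K * k.factorial / r ^ k) → ∀ ξ : ℝ,
      ‖∫ u in (-Real.pi)..Real.pi, cutoff c u * h 0 u * Complex.exp (-(Complex.I * ξ * u))‖ ≤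
        C * K * Real.exp (-(a * √|ξ|)) := by
  have hπ := Real.pi_pos
  set α := 2 / (c * Real.pi)
  have hα : 0 < α := by positivity
  set q := 8 * α + 1 / r
  have hq : 0 < q := by positivity
  -- The rate comes from `y = √(|ξ| / (3q))`: `3` from the Leibniz branching, `q` from the Gevrey
  -- bound on the jets.
  refine ⟨1 / √(3 * q), by positivity, 4 * (Real.exp c * (2 * Real.pi)), by positivity,
    fun h K hd hM ξ => ?_⟩
  have hK : 0 ≤ K := by
    have := (norm_nonneg _).trans (hM 0 0 (by simp [Real.pi_pos]))
    simpa using this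
  have hmain := pow_mul_norm_integral_le (cutoffMulJet α h)
    (fun m => K * q ^ m * (m.factorial : ℝ) ^ 2) (hasDerivAt_cutoffMulJet hα hd hM)
    (fun i j k => by simp [cutoffMulJet, abs_of_pos hπ])
    (norm_cutoffMulJet_le hα hr hM) ξ
  have hint : (∫ u in (-Real.pi)..Real.pi,
      cutoff c u * h 0 u * Complex.exp (-(Complex.I * ξ * u))) = Real.exp c *
      ∫ u in (-Real.pi)..Real.pi, cutoffMulJet α h 0 0 0 u *
        Complex.exp (-(Complex.I * ξ * u)) := by
    rw [← intervalIntegral.integral_const_mul]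
    congr 1 with u
    rw [cutoff_mul_eq_cutoffMulJet hc]
    ring
  rw [hint, norm_mul, Complex.norm_real, Real.norm_eq_abs, abs_of_pos (Real.exp_pos c)]
  have hdec := le_exp_neg_of_forall_pow_mul_le (y := √(|ξ| / (3 * q)))
    (A := ‖∫ u in (-Real.pi)..Real.pi, cutoffMulJet α h 0 0 0 u *
        Complex.exp (-(Complex.I * ξ * u))‖) (C := 2 * Real.pi * K) (norm_nonneg _)
    (by positivity) (fun n => by
      rw [pow_mul, Real.sq_sqrt (by positivity), div_pow, div_mul_eq_mul_div,
        div_le_iff₀ (by positivity)]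
      refine (hmain n 0 0 0).trans_eq ?_
      simp only [zero_add]
      rw [mul_pow]
      ring)
  rw [Real.sqrt_div (abs_nonneg ξ)] at hdec
  calc _ ≤ Real.exp c * (4 * (2 * Real.pi * K) * Real.exp (-(√|ξ| / √(3 * q)))) := by gcongr
    _ = _ := by
      rw [show √|ξ| / √(3 * q) = 1 / √(3 * q) * √|ξ| by ring]
      ring

/-! ### Fourier inversion and tails of series -/

theorem hasSum_fourier_of_summable {G : ℝ → ℂ} (hG : Continuous G)
    (hper : G (-Real.pi) = G Real.pi)
    (hsum : Summable fun k : ℤ => 1 / (2 * Real.pi) *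
      ∫ y in (-Real.pi)..Real.pi, G y * Complex.exp (-(Complex.I * k * y)))
    {x : ℝ} (hx : |x| < Real.pi) :
    HasSum (fun k : ℤ => 1 / (2 * Real.pi) *
      (∫ y in (-Real.pi)..Real.pi, G y * Complex.exp (-(Complex.I * k * y))) *
        Complex.exp (Complex.I * k * x)) (G x) := by
  have hπ := Real.pi_pos
  have hπ' : (Real.pi : ℂ) ≠ 0 := by exact_mod_cast hπ.ne'
  have : Fact (0 < 2 * Real.pi) := ⟨by positivity⟩
  have he : -Real.pi + 2 * Real.pi = Real.pi := by ring
  let g : C(AddCircle (2 * Real.pi), ℂ) := ⟨AddCircle.liftIco (2 * Real.pi) (-Real.pi) G,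
    AddCircle.liftIco_continuous (by rw [he]; exact hper) hG.continuousOn⟩
  have hcoef : ∀ k : ℤ, fourierCoeff g k = 1 / (2 * Real.pi) *
      ∫ y in (-Real.pi)..Real.pi, G y * Complex.exp (-(Complex.I * k * y)) := fun k => by
    change fourierCoeff (AddCircle.liftIco (2 * Real.pi) (-Real.pi) G) k = _
    rw [fourierCoeff_liftIco_eq, fourierCoeffOn_eq_integral, he]
    rw [show Real.pi - -Real.pi = 2 * Real.pi by ring, Complex.real_smul]
    push_cast
    congr 1
    apply intervalIntegral.integral_congr
    intro y _
    simp only [smul_eq_mul, mul_comm (G y)]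
    rw [fourier_coe_apply]
    congr 2
    push_cast
    field_simp
  have h := has_pointwise_sum_fourier_series_of_summable (f := g)
    ((funext hcoef) ▸ hsum) (x : AddCircle (2 * Real.pi))
  rw [abs_lt] at hx
  have hgx : g (x : AddCircle (2 * Real.pi)) = G x :=
    AddCircle.liftIco_coe_apply (by rw [he]; exact ⟨hx.1.le, hx.2⟩)
  rw [hgx] at h
  convert h using 2 with k
  rw [hcoef, smul_eq_mul, fourier_coe_apply]
  congr 2
  push_cast
  field_simp

theorem norm_tsum_sub_sum_Icc_le {u : ℤ → ℂ} {b : ℝ} {N : ℕ} (hb : 0 ≤ b)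
    (hu : ∀ k : ℤ, (N : ℤ) < |k| → ‖u k‖ ≤ b / (k : ℝ) ^ 2) :
    Summable u ∧ ‖∑' k, u k - ∑ k ∈ Finset.Icc (-(N : ℤ)) N, u k‖ ≤ 4 * b / (N + 1) := by
  classical
  set g : ℤ → ℝ := fun k => if (N : ℤ) < |k| then b / (k : ℝ) ^ 2 else 0 with hg
  have hg0 : ∀ k, 0 ≤ g k := fun k => by simp only [hg]; split_ifs <;> positivity
  have hgs : Summable g := by
    refine Summable.of_nonneg_of_le hg0 (fun k => ?_)
      ((Real.summable_one_div_int_pow (p := 2)).2 (by norm_num) |>.mul_left b)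
    simp only [hg]
    split_ifs
    · rw [mul_one_div]
    · positivity
  have hnat : ∀ n : ℕ, g (n : ℤ) = if N < n then b / (n : ℝ) ^ 2 else 0 := fun n => by
    simp [hg]
  have hpart : ∀ n : ℕ, ∑ i ∈ Finset.range n, g (i : ℤ) ≤ 2 * b / (N + 1) := fun n => by
    have h1 := sum_Ioo_inv_sq_le (α := ℝ) N n
    calc _ = ∑ i ∈ Finset.Ioo N n, b * ((i : ℝ) ^ 2)⁻¹ := by
          simp_rw [hnat]
          rw [← Finset.sum_filter]
          refine Finset.sum_congr ?_ fun i _ => div_eq_mul_inv _ _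
          ext i
          simp [and_comm]
      _ = b * ∑ i ∈ Finset.Ioo N n, ((i : ℝ) ^ 2)⁻¹ := by rw [Finset.mul_sum]
      _ ≤ b * (2 / (N + 1)) := by gcongr
      _ = _ := by ring
  have hneg : ∀ k, g (-k) = g k := fun k => by simp [hg]
  have hgt : ∑' k, g k ≤ 4 * b / (N + 1) := by
    have h1 : Summable fun n : ℕ => g n := hgs.comp_injective Nat.cast_injective
    have h2 : Summable fun n : ℕ => g (-((n : ℤ) + 1)) := by
      simp_rw [hneg]
      exact_mod_cast (summable_nat_add_iff 1).2 h1
    rw [(HasSum.of_nat_of_neg_add_one h1.hasSum h2.hasSum).tsum_eq]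
    have h3 : ∑' n : ℕ, g n ≤ 2 * b / (N + 1) := Real.tsum_le_of_sum_range_le (fun _ => hg0 _) hpart
    have h4 : ∑' n : ℕ, g (-((n : ℤ) + 1)) ≤ 2 * b / (N + 1) := by
      refine Real.tsum_le_of_sum_range_le (fun _ => hg0 _) fun n => ?_
      refine le_trans ?_ (hpart (n + 1))
      rw [Finset.sum_range_succ']
      simp_rw [hneg]
      push_cast
      linarith [hg0 0]
    calc _ ≤ 2 * b / (N + 1) + 2 * b / (N + 1) := add_le_add h3 h4
      _ = _ := by ring
  -- The central terms carry no bound; they are removed, and `u - v` is a finite sum.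
  set v : ℤ → ℂ := fun k => if (N : ℤ) < |k| then u k else 0 with hv
  have hvg : ∀ k, ‖v k‖ ≤ g k := fun k => by
    simp only [hv, hg]
    split_ifs with h
    · exact hu k h
    · simp
  have hvs : Summable v := Summable.of_norm_bounded hgs hvg
  have hdiff : ∀ k, k ∉ Finset.Icc (-(N : ℤ)) N → u k - v k = 0 := fun k hk => by
    rw [Finset.mem_Icc, ← abs_le, not_le] at hk
    simp [hv, hk]
  have hd : HasSum (fun k => u k - v k) (∑ k ∈ Finset.Icc (-(N : ℤ)) N, (u k - v k)) :=
    hasSum_sum_of_ne_finset_zero hdiff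
  have hsum : ∑ k ∈ Finset.Icc (-(N : ℤ)) N, (u k - v k) = ∑ k ∈ Finset.Icc (-(N : ℤ)) N, u k :=
    Finset.sum_congr rfl fun k hk => by
      rw [Finset.mem_Icc, ← abs_le, ← not_lt] at hk
      simp [hv, hk]
  rw [hsum] at hd
  have hus : HasSum u (∑ k ∈ Finset.Icc (-(N : ℤ)) N, u k + ∑' k, v k) := by
    simpa using hd.add hvs.hasSum
  refine ⟨hus.summable, ?_⟩
  rw [hus.tsum_eq, add_sub_cancel_left]
  exact (tsum_of_norm_bounded hgs.hasSum hvg).trans hgt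

/-! ### Bounded variation and decay of the Fourier coefficients -/

namespace SpectralMollifier

theorem IsPiecewiseAnalytic.intervalIntegrable {f : ℝ → ℂ} (hper : Function.Periodic f (2 * Real.pi))
    (hf : IsPiecewiseAnalytic f) (a b : ℝ) :
    IntervalIntegrable f MeasureTheory.volume a b := by
  obtain ⟨n, t, hlt, htn, hg⟩ := hf
  have hpi : ∀ i < n, IntervalIntegrable f MeasureTheory.volume (t i) (t (i + 1)) := fun i hi => by
    obtain ⟨g, hga, hfg⟩ := hg i hi
    have h1 : IntervalIntegrable g MeasureTheory.volume (t i) (t (i + 1)) :=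
      hga.continuousOn.intervalIntegrable_of_Icc (hlt i hi).le
    rw [intervalIntegrable_iff_integrableOn_Ioo_of_le (hlt i hi).le] at h1 ⊢
    exact h1.congr_fun hfg.symm measurableSet_Ioo
  have h := IntervalIntegrable.trans_iterate hpi
  rw [htn] at h
  exact hper.intervalIntegrable (by simp [Real.pi_ne_zero]) h _ _

/-- On each open piece `f` agrees with a Lipschitz function. The arbitrary values at break points
add only the finite distances to the one-sided limits. Periodicity then covers any interval. -/
theorem IsPiecewiseAnalytic.boundedVariationOn {f : ℝ → ℂ}
    (hper : Function.Periodic f (2 * Real.pi)) (hf : IsPiecewiseAnalytic f) (a b : ℝ) :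
    BoundedVariationOn f (Set.Icc a b) := by
  obtain ⟨n, t, hlt, htn, hg⟩ := hf
  have hpi : ∀ i < n, BoundedVariationOn f (Set.Icc (t i) (t (i + 1))) := fun i hi => by
    obtain ⟨g, hga, hfg⟩ := hg i hi
    have hab := hlt i hi
    generalize t i = a at *
    generalize t (i + 1) = b at *
    have hgb : BoundedVariationOn g (Set.Ioo a b) := by
      obtain ⟨K, hK⟩ := (hga.contDiffOn (n := 1) (uniqueDiffOn_Icc hab)
        |>.exists_lipschitzOnWith (by simp) (convex_Icc a b) isCompact_Icc)
      have h1 := hK.locallyBoundedVariationOn a b (Set.left_mem_Icc.2 hab.le)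
        (Set.right_mem_Icc.2 hab.le)
      rw [Set.inter_self] at h1
      exact h1.mono Set.Ioo_subset_Icc_self
    have hfb : BoundedVariationOn f (Set.Ioo a b) := by
      unfold BoundedVariationOn
      rw [eVariationOn.congr hfg]
      exact hgb
    have hIco : Set.Ioo a b ∈ nhdsWithin a (Set.Ioi a) := Ioo_mem_nhdsGT hab
    have hIoc : Set.Ioo a b ∈ nhdsWithin b (Set.Iio b) := Ioo_mem_nhdsLT hab
    have ha : Filter.Tendsto f (nhdsWithin a (Set.Ioo a b)) (nhds (g a)) := by
      have := (hga a (Set.left_mem_Icc.2 hab.le)).continuousAt.tendsto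
      exact (this.mono_left nhdsWithin_le_nhds).congr'
        (Filter.eventuallyEq_of_mem self_mem_nhdsWithin hfg.symm)
    have hb : Filter.Tendsto f (nhdsWithin b (Set.Ioo a b)) (nhds (g b)) := by
      have := (hga b (Set.right_mem_Icc.2 hab.le)).continuousAt.tendsto
      exact (this.mono_left nhdsWithin_le_nhds).congr'
        (Filter.eventuallyEq_of_mem self_mem_nhdsWithin hfg.symm)
    have e1 : Set.Ico a b ∩ Set.Ici a = Set.Ico a b := by ext; simp
    have e2 : Set.Ico a b ∩ Set.Ioi a = Set.Ioo a b := by ext; simp; grind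
    have e3 : Set.Icc a b ∩ Set.Iic b = Set.Icc a b := by ext; simp
    have e4 : Set.Icc a b ∩ Set.Iio b = Set.Ico a b := by ext; simp; grind
    have s1 := eVariationOn.eVariationOn_on_inter_Ici_eq_Ioi_add_edist (f := f)
      (s := Set.Ico a b) (a := a) (l := g a)
      (by rw [e2, nhdsWithin_Ioo_eq_nhdsGT hab]; infer_instance) (Set.left_mem_Ico.2 hab)
      (by rw [e2]; exact ha)
    have s2 := eVariationOn.eVariationOn_on_inter_Iic_eq_Iio_add_edist (f := f)
      (s := Set.Icc a b) (a := b) (l := g b)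
      (by rw [e4, nhdsWithin_Ico_eq_nhdsLT hab]; infer_instance) (Set.right_mem_Icc.2 hab.le)
      (by rw [e4, nhdsWithin_Ico_eq_nhdsLT hab, ← nhdsWithin_Ioo_eq_nhdsLT hab]; exact hb)
    rw [e1, e2] at s1
    rw [e3, e4, s1] at s2
    unfold BoundedVariationOn at hfb ⊢
    rw [s2]
    finiteness
  have hnmono : ∀ m ≤ n, t 0 ≤ t m ∧ BoundedVariationOn f (Set.Icc (t 0) (t m)) := fun m => by
    induction m with
    | zero => intro _; simp [BoundedVariationOn]
    | succ m ih =>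
      intro hm
      obtain ⟨h1, h2⟩ := ih (by omega)
      have h3 := (hlt m (by omega)).le
      refine ⟨h1.trans h3, ?_⟩
      have h4 := eVariationOn.Icc_add_Icc f (s := Set.univ) h1 h3 (Set.mem_univ _)
      simp only [Set.univ_inter] at h4
      unfold BoundedVariationOn at *
      rw [← h4]
      exact ENNReal.add_ne_top.2 ⟨h2, hpi m (by omega)⟩
  have hbase := (hnmono n le_rfl).2
  rw [htn] at hbase
  have hshift : ∀ m : ℤ, BoundedVariationOn f
      (Set.Icc (t 0 + m * (2 * Real.pi)) (t 0 + (m + 1) * (2 * Real.pi))) := fun m => by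
    have h1 := eVariationOn.comp_le_of_monotoneOn f (s := Set.Icc (t 0) (t 0 + 2 * Real.pi))
      (t := Set.Icc (t 0 + m * (2 * Real.pi)) (t 0 + (m + 1) * (2 * Real.pi)))
      (fun x => x - m * (2 * Real.pi)) (fun x _ y _ h => by simpa using h)
      (fun x hx => ⟨by linarith [hx.1], by linarith [hx.2]⟩)
    have h2 : f ∘ (fun x => x - m * (2 * Real.pi)) = f := funext fun x => hper.sub_int_mul_eq m
    rw [h2] at h1
    exact ne_top_of_le_ne_top hbase h1
  have hlong : ∀ (m : ℤ) (l : ℕ), BoundedVariationOn f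
      (Set.Icc (t 0 + m * (2 * Real.pi)) (t 0 + (m + l) * (2 * Real.pi))) := fun m l => by
    have hπ := Real.pi_pos
    induction l with
    | zero => simp [BoundedVariationOn]
    | succ l ih =>
      have h4 := eVariationOn.Icc_add_Icc f (s := Set.univ) (a := t 0 + m * (2 * Real.pi))
        (b := t 0 + (m + l) * (2 * Real.pi)) (c := t 0 + (m + (l + 1)) * (2 * Real.pi))
        (by gcongr; simp) (by gcongr; simp) (Set.mem_univ _)
      simp only [Set.univ_inter] at h4
      unfold BoundedVariationOn at *
      push_cast
      rw [← h4]
      refine ENNReal.add_ne_top.2 ⟨ih, ?_⟩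
      have := hshift (m + l)
      push_cast at this
      rwa [add_assoc (m : ℝ)] at this
  have h2π : 0 < 2 * Real.pi := Real.two_pi_pos
  obtain ⟨m, hm⟩ := exists_int_lt ((a - t 0) / (2 * Real.pi))
  obtain ⟨l, hl⟩ := exists_nat_gt ((b - t 0) / (2 * Real.pi) - m)
  rw [lt_div_iff₀ h2π] at hm
  rw [sub_lt_iff_lt_add, div_lt_iff₀ h2π] at hl
  exact (hlong m l).mono (Set.Icc_subset_Icc (by linarith) (by linarith))

end SpectralMollifier

theorem eVariationOn_Icc_zero_two_nsmul_period_le {f : ℝ → ℂ} {T : ℝ} (hT : 0 ≤ T)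
    (hper : Function.Periodic f T) :
    eVariationOn f (Set.Icc 0 (2 * T)) ≤ 2 * eVariationOn f (Set.Icc 0 T) := by
  have h4 := eVariationOn.Icc_add_Icc f (s := Set.univ) (a := 0) (b := T) (c := 2 * T)
    hT (by linarith) (Set.mem_univ _)
  simp only [Set.univ_inter] at h4
  have h1 := eVariationOn.comp_le_of_monotoneOn f (s := Set.Icc 0 T)
    (t := Set.Icc T (2 * T)) (fun x => x - T) (fun x _ y _ h => by simpa using h)
    (fun x hx => ⟨by linarith [hx.1], by linarith [hx.2]⟩)
  have h2 : f ∘ (fun x => x - T) = f := funext fun x => hper.sub_eq x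
  rw [h2] at h1
  rw [← h4, two_mul (eVariationOn _ _)]
  exact add_le_add le_rfl h1

/-- Cutting the period into `n` cells of length `T / n` and superposing them, the integrand at
offset `x` becomes a variation sum along `x, x + T/n, …`, which stays within two periods. -/
theorem integral_norm_sub_shift_le {f : ℝ → ℂ} {T : ℝ} (hT : 0 < T)
    (hper : Function.Periodic f T)
    (hint : ∀ a b, IntervalIntegrable f MeasureTheory.volume a b)
    (hbv : BoundedVariationOn f (Set.Icc 0 T)) {n : ℕ} (hn : 0 < n) :
    ∫ x in (0 : ℝ)..T, ‖f (x + T / n) - f x‖ ≤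
      T / n * (2 * (eVariationOn f (Set.Icc 0 T)).toReal) := by
  set h := T / n with hh
  have hn' : (0 : ℝ) < n := by exact_mod_cast hn
  have hh0 : 0 < h := by positivity
  have hnh : n * h = T := by rw [hh]; field_simp
  have hwint : ∀ a b, IntervalIntegrable (fun x => ‖f (x + h) - f x‖) MeasureTheory.volume a b :=
    fun a b => ((by simpa using (hint (a + h) (b + h)).comp_add_right h :
      IntervalIntegrable (fun x => f (x + h)) MeasureTheory.volume a b).sub (hint a b)).norm
  have h1 := intervalIntegral.sum_integral_adjacent_intervals (μ := MeasureTheory.volume)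
    (f := fun x => ‖f (x + h) - f x‖) (a := fun j : ℕ => (j : ℝ) * h) (n := n)
    (fun j _ => hwint _ _)
  simp only [Nat.cast_zero, zero_mul, hnh] at h1
  have h2 : ∀ j : ℕ, ∫ x in ((j : ℝ) * h)..(((j + 1 : ℕ) : ℝ) * h), ‖f (x + h) - f x‖ =
      ∫ x in (0 : ℝ)..h, ‖f (x + (j + 1) * h) - f (x + j * h)‖ := fun j => by
    have := intervalIntegral.integral_comp_add_right (a := 0) (b := h)
      (fun x => ‖f (x + h) - f x‖) (j * h)
    rw [zero_add, show h + j * h = ((j + 1 : ℕ) : ℝ) * h by push_cast; ring] at this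
    rw [← this]
    congr 1 with x
    congr 3
    ring
  have hint2 : ∀ j : ℕ, IntervalIntegrable (fun x => ‖f (x + (j + 1) * h) - f (x + j * h)‖)
      MeasureTheory.volume 0 h := fun j =>
    ((by simpa using (hint (0 + (j + 1) * h) (h + (j + 1) * h)).comp_add_right ((j + 1) * h) :
      IntervalIntegrable (fun x => f (x + (j + 1) * h)) MeasureTheory.volume 0 h).sub
      (by simpa using (hint (0 + j * h) (h + j * h)).comp_add_right (j * h))).norm
  rw [← h1, Finset.sum_congr rfl fun j _ => h2 j,
    ← intervalIntegral.integral_finsetSum fun j _ => hint2 j]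
  have hbound : ∀ x ∈ Set.Icc 0 h, ∑ j ∈ Finset.range n,
      ‖f (x + (j + 1) * h) - f (x + j * h)‖ ≤ 2 * (eVariationOn f (Set.Icc 0 T)).toReal := by
    intro x hx
    have hmem : ∀ i ≤ n, x + i * h ∈ Set.Icc 0 (2 * T) := fun i hi => by
      have hi' : (i : ℝ) ≤ n := by exact_mod_cast hi
      have h3 : (i : ℝ) * h ≤ T := by rw [← hnh]; gcongr
      have h4 : h ≤ T := by
        rw [← hnh]
        exact le_mul_of_one_le_left hh0.le (by exact_mod_cast hn)
      have h5 : 0 ≤ (i : ℝ) * h := by positivity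
      exact ⟨by linarith [hx.1], by linarith [hx.2]⟩
    have h3 := (eVariationOn.sum_le_of_monotoneOn_Iic (f := f) (s := Set.Icc 0 (2 * T))
      (n := n) (u := fun i : ℕ => x + i * h) (fun i _ j _ hij => by
        have : (i : ℝ) ≤ j := by exact_mod_cast hij
        simp only
        gcongr) hmem).trans (eVariationOn_Icc_zero_two_nsmul_period_le hT.le hper)
    have h4 := ENNReal.toReal_mono (by finiteness [hbv]) h3
    rw [ENNReal.toReal_sum (fun _ _ => edist_ne_top _ _), ENNReal.toReal_mul] at h4
    simpa [edist_dist, dist_eq_norm] using h4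
  have h6 := intervalIntegral.integral_mono_on (μ := MeasureTheory.volume) hh0.le
    (IntervalIntegrable.sum _ fun j _ => hint2 j)
    (intervalIntegrable_const (c := 2 * (eVariationOn f (Set.Icc 0 T)).toReal))
    (fun x hx => by simpa using hbound x hx)
  rw [intervalIntegral.integral_const, smul_eq_mul, sub_zero] at h6
  simpa only [Finset.sum_apply] using h6

namespace SpectralMollifier

/-- A shift by half a wavelength, `π/|k|`, changes the sign of the exponential, so twice the
coefficient is the coefficient of a difference `f(x) - f(x + h)`, whose `L¹` norm is controlled by
the variation. -/
theorem norm_fourierCoef_le {f : ℝ → ℂ} (hper : Function.Periodic f (2 * Real.pi))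
    (hint : ∀ a b, IntervalIntegrable f MeasureTheory.volume a b)
    (hbv : BoundedVariationOn f (Set.Icc 0 (2 * Real.pi))) {k : ℤ} (hk : k ≠ 0) :
    ‖fourierCoef f k‖ ≤ (eVariationOn f (Set.Icc 0 (2 * Real.pi))).toReal / |(k : ℝ)| := by
  have hπ := Real.pi_pos
  set V := (eVariationOn f (Set.Icc 0 (2 * Real.pi))).toReal
  have hk' : (k : ℝ) ≠ 0 := by exact_mod_cast hk
  set n := 2 * k.natAbs with hn
  have hn0 : 0 < n := by have := Int.natAbs_pos.2 hk; omega
  have hnk : (n : ℝ) = 2 * |(k : ℝ)| := by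
    rw [hn]; push_cast; rw [Nat.cast_natAbs]; push_cast; rfl
  set h := 2 * Real.pi / n with hh
  set E : ℝ → ℂ := fun x => Complex.exp (-(Complex.I * k * x)) with hE
  have hEc : Continuous E := by fun_prop
  have hEh : ∀ x, E (x + h) = -E x := fun x => by
    have h1 : E (x + h) = E x * Complex.exp (-(Complex.I * k * h)) := by
      rw [hE, ← Complex.exp_add]; push_cast; ring_nf
    have h2 : Complex.exp (-(Complex.I * k * h)) = -1 := by
      have hkh : (k : ℝ) * h = Real.pi ∨ (k : ℝ) * h = -Real.pi := by
        rw [hh, hnk]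
        rcases abs_choice (k : ℝ) with h | h <;> rw [h]
        · left; field_simp
        · right; field_simp
      rcases hkh with h3 | h3
      · rw [mul_assoc, show (k : ℂ) * (h : ℂ) = (Real.pi : ℂ) by exact_mod_cast h3, mul_comm,
          Complex.exp_neg, Complex.exp_pi_mul_I]
        norm_num
      · rw [mul_assoc, show (k : ℂ) * (h : ℂ) = -(Real.pi : ℂ) by exact_mod_cast h3, mul_neg,
          neg_neg, mul_comm, Complex.exp_pi_mul_I]
    rw [h1, h2]; ring
  have hEper : Function.Periodic E (2 * Real.pi) := fun x => by
    have : E (x + 2 * Real.pi) = E x * Complex.exp (((-k : ℤ) : ℂ) * (2 * Real.pi * Complex.I)) := by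
      rw [hE, ← Complex.exp_add]; push_cast; ring_nf
    rw [this, Complex.exp_int_mul_two_pi_mul_I, mul_one]
  set F : ℝ → ℂ := fun x => f x * E x with hF
  have hFper : Function.Periodic F (2 * Real.pi) := hper.mul hEper
  have hFint : ∀ a b, IntervalIntegrable F MeasureTheory.volume a b := fun a b =>
    (hint a b).mul_continuousOn hEc.continuousOn
  have i0 : ∫ x in (-Real.pi)..Real.pi, F x = ∫ x in (0 : ℝ)..(2 * Real.pi), F x := by
    have := hFper.intervalIntegral_add_eq (-Real.pi) 0
    rwa [zero_add, show -Real.pi + 2 * Real.pi = Real.pi by ring] at this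
  have i1 : ∫ x in (0 : ℝ)..(2 * Real.pi), F (x + h) = ∫ x in (0 : ℝ)..(2 * Real.pi), F x := by
    rw [intervalIntegral.integral_comp_add_right, zero_add]
    have := hFper.intervalIntegral_add_eq h 0
    rwa [zero_add, add_comm h] at this
  have hfs : ∀ a b, IntervalIntegrable (fun x => f (x + h)) MeasureTheory.volume a b := fun a b => by
    simpa using (hint (a + h) (b + h)).comp_add_right h
  have hFs : ∀ a b, IntervalIntegrable (fun x => F (x + h)) MeasureTheory.volume a b := fun a b => by
    simpa using (hFint (a + h) (b + h)).comp_add_right h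
  have i2 : 2 * ∫ x in (0 : ℝ)..(2 * Real.pi), F x =
      ∫ x in (0 : ℝ)..(2 * Real.pi), -(f (x + h) - f x) * E x := by
    calc _ = (∫ x in (0 : ℝ)..(2 * Real.pi), F x) + ∫ x in (0 : ℝ)..(2 * Real.pi), F (x + h) := by
          rw [i1]; ring
      _ = _ := by
          rw [← intervalIntegral.integral_add (hFint _ _) (hFs _ _)]
          congr 1 with x
          simp only [hF, hEh]
          ring
  have i3 : ‖∫ x in (0 : ℝ)..(2 * Real.pi), -(f (x + h) - f x) * E x‖ ≤
      ∫ x in (0 : ℝ)..(2 * Real.pi), ‖f (x + h) - f x‖ := by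
    refine (intervalIntegral.norm_integral_le_integral_norm (by positivity)).trans_eq ?_
    congr 1 with x
    rw [norm_mul, norm_neg, hE]
    simp only
    rw [show -(Complex.I * k * x) = ((-(k * x) : ℝ) : ℂ) * Complex.I by push_cast; ring,
      Complex.norm_exp_ofReal_mul_I, mul_one]
  have i4 := i3.trans (integral_norm_sub_shift_le (by positivity) hper hint hbv hn0)
  rw [← i2, norm_mul, Complex.norm_two] at i4
  have hfc : fourierCoef f k = 1 / (2 * Real.pi) * ∫ x in (0 : ℝ)..(2 * Real.pi), F x := by
    rw [fourierCoef, i0]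
  rw [hfc, norm_mul, show (1 / (2 * Real.pi) : ℂ) = ((1 / (2 * Real.pi) : ℝ) : ℂ) by push_cast; rfl,
    Complex.norm_real, Real.norm_eq_abs, abs_of_pos (by positivity)]
  have hV : 0 ≤ V := ENNReal.toReal_nonneg
  have hka : 0 < |(k : ℝ)| := by positivity
  calc _ ≤ 1 / (2 * Real.pi) * (2 * Real.pi / n * V) := by gcongr; linarith
    _ = V / n := by field_simp
    _ ≤ V / |(k : ℝ)| := by gcongr; rw [hnk]; linarith

end SpectralMollifier

/-! ### The recovered value on the Fourier side -/

namespace SpectralMollifier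

/-- The Fourier transform of `ρ_c D_p`, at the frequency `ξ`. -/
noncomputable def symbol (c : ℝ) (p : ℕ) (ξ : ℝ) : ℂ :=
  ∫ u in (-Real.pi)..Real.pi, cutoff c u * dirichletKernel p u * Complex.exp (-(Complex.I * ξ * u))

theorem continuous_dirichletKernel (p : ℕ) : Continuous (dirichletKernel p) := by
  unfold dirichletKernel
  fun_prop

theorem integral_cutoff_mul (c : ℝ) (g : ℝ → ℂ) :
    ∫ u : ℝ, cutoff c u * g u = ∫ u in (-Real.pi)..Real.pi, cutoff c u * g u := by
  symm
  apply intervalIntegral.integral_eq_integral_of_support_subset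
  intro u hu
  have : |u| < Real.pi := by
    by_contra h
    exact hu (by simp [cutoff_of_pi_le_abs c (not_lt.1 h)])
  rw [abs_lt] at this
  exact ⟨this.1, this.2.le⟩

theorem integral_mollifier_mul (c : ℝ) (p : ℕ) {θ : ℝ} (hθ : 0 < θ) (H : ℝ → ℂ) :
    ∫ y : ℝ, mollifier c p θ y * H y =
      ∫ u in (-Real.pi)..Real.pi, cutoff c u * (dirichletKernel p u * H (θ * u)) := by
  rw [← integral_cutoff_mul]
  have h := MeasureTheory.Measure.integral_comp_div
    (fun u => (cutoff c u : ℂ) * (dirichletKernel p u * H (θ * u))) θ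
  rw [abs_of_pos hθ] at h
  have h2 : ∫ y : ℝ, mollifier c p θ y * H y = ((1 / θ : ℝ) : ℂ) *
      ∫ y : ℝ, (cutoff c (y / θ) : ℂ) * (dirichletKernel p (y / θ) * H (θ * (y / θ))) := by
    rw [← MeasureTheory.integral_const_mul]
    congr 1 with y
    rw [mul_div_cancel₀ _ hθ.ne', mollifier]
    ring
  rw [h2, h, Complex.real_smul, ← mul_assoc, ← Complex.ofReal_mul, one_div_mul_cancel hθ.ne',
    Complex.ofReal_one, one_mul]

theorem mollifier_of_pi_le_abs (c : ℝ) (p : ℕ) {θ : ℝ} (hθ : 0 < θ) (hθ1 : θ ≤ 1) {y : ℝ}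
    (hy : Real.pi ≤ |y|) : mollifier c p θ y = 0 := by
  have : Real.pi ≤ |y / θ| := by
    rw [abs_div, abs_of_pos hθ, le_div_iff₀ hθ]
    nlinarith [Real.pi_pos]
  simp [mollifier, cutoff_of_pi_le_abs c this]

theorem integral_mollifier_mul_interval (c : ℝ) (p : ℕ) {θ : ℝ} (hθ : 0 < θ) (hθ1 : θ ≤ 1)
    (H : ℝ → ℂ) :
    ∫ y in (-Real.pi)..Real.pi, mollifier c p θ y * H y =
      ∫ u in (-Real.pi)..Real.pi, cutoff c u * (dirichletKernel p u * H (θ * u)) := by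
  rw [← integral_mollifier_mul c p hθ]
  apply intervalIntegral.integral_eq_integral_of_support_subset
  intro u hu
  have : |u| < Real.pi := by
    by_contra h
    exact hu (by simp [mollifier_of_pi_le_abs c p hθ hθ1 (not_lt.1 h)])
  rw [abs_lt] at this
  exact ⟨this.1, this.2.le⟩

theorem recovered_eq_sum {c : ℝ} (hc : 0 < c) (p : ℕ) {θ : ℝ} (hθ : 0 < θ) (N : ℕ) (f : ℝ → ℂ)
    (x : ℝ) :
    recovered c p θ N f x = ∑ k ∈ Finset.Icc (-(N : ℤ)) N,
      fourierCoef f k * Complex.exp (Complex.I * k * x) * symbol c p (k * θ) := by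
  have hρ := continuous_cutoff hc
  have hD := continuous_dirichletKernel p
  unfold recovered
  rw [MeasureTheory.convolution_def]
  simp only [ContinuousLinearMap.mul_apply']
  rw [integral_mollifier_mul c p hθ (fun y => fourierProj N f (x - y))]
  have : ∀ u : ℝ, (cutoff c u : ℂ) * (dirichletKernel p u * fourierProj N f (x - θ * u)) =
      ∑ k ∈ Finset.Icc (-(N : ℤ)) N, fourierCoef f k * Complex.exp (Complex.I * k * x) *
        (cutoff c u * dirichletKernel p u *
          Complex.exp (-(Complex.I * ((k * θ : ℝ) : ℂ) * u))) := fun u => by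
    rw [fourierProj, Finset.mul_sum, Finset.mul_sum]
    refine Finset.sum_congr rfl fun k _ => ?_
    have : Complex.exp (Complex.I * k * ((x - θ * u : ℝ) : ℂ)) =
        Complex.exp (Complex.I * k * x) * Complex.exp (-(Complex.I * ((k * θ : ℝ) : ℂ) * u)) := by
      rw [← Complex.exp_add]; push_cast; ring_nf
    rw [this]
    ring
  simp_rw [this]
  rw [intervalIntegral.integral_finsetSum fun k _ => by
    apply Continuous.intervalIntegrable; fun_prop]
  simp_rw [intervalIntegral.integral_const_mul]
  rfl

/-- It is the mollifier, not `f`, that is expanded in a Fourier series: that series converges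
absolutely and can be integrated against `f` term by term. The condition `θ ≤ 1` keeps the
mollifier's support inside one period. -/
theorem hasSum_fourierCoef_mul_symbol {c : ℝ} (hc : 0 < c) (p : ℕ) {θ : ℝ} (hθ : 0 < θ)
    (hθ1 : θ ≤ 1) {f : ℝ → ℂ} (hper : Function.Periodic f (2 * Real.pi))
    (hint : ∀ a b, IntervalIntegrable f MeasureTheory.volume a b) (x : ℝ)
    (hs : Summable fun k : ℤ => symbol c p (k * θ)) :
    HasSum (fun k : ℤ => fourierCoef f k * Complex.exp (Complex.I * k * x) * symbol c p (k * θ))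
      (∫ u in (-Real.pi)..Real.pi, cutoff c u * (dirichletKernel p u * f (x - θ * u))) := by
  have hρ := continuous_cutoff hc
  have hD := continuous_dirichletKernel p
  have hπ := Real.pi_pos
  have hψ : Continuous (mollifier c p θ) := by
    unfold mollifier
    fun_prop
  have hsym : ∀ k : ℤ, ∫ y in (-Real.pi)..Real.pi, mollifier c p θ y *
      Complex.exp (-(Complex.I * k * y)) = symbol c p (k * θ) := fun k => by
    have := integral_mollifier_mul_interval c p hθ hθ1 (fun y => Complex.exp (-(Complex.I * k * y)))
    rw [this, symbol]
    congr 1 with u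
    push_cast
    rw [mul_assoc]
    ring_nf
  have hinv : ∀ y : ℝ, |y| < Real.pi → HasSum (fun k : ℤ => 1 / (2 * Real.pi) * symbol c p (k * θ) *
      Complex.exp (Complex.I * k * y)) (mollifier c p θ y) := fun y hy => by
    have := hasSum_fourier_of_summable hψ (by
      rw [mollifier_of_pi_le_abs c p hθ hθ1 (by simp [abs_of_pos hπ]),
        mollifier_of_pi_le_abs c p hθ hθ1 (by simp [abs_of_pos hπ])])
      (by simp_rw [hsym]; exact hs.mul_left _) hy
    simpa only [hsym] using this
  have hfx : IntervalIntegrable (fun y => f (x - y)) MeasureTheory.volume (-Real.pi) Real.pi := by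
    simpa using (hint (x + Real.pi) (x - Real.pi)).comp_sub_left x
  have key := intervalIntegral.hasSum_integral_of_dominated_convergence (μ := MeasureTheory.volume)
    (a := -Real.pi) (b := Real.pi)
    (F := fun (k : ℤ) y => 1 / (2 * Real.pi) * symbol c p (k * θ) *
      Complex.exp (Complex.I * k * y) * f (x - y))
    (f := fun y => mollifier c p θ y * f (x - y))
    (fun k y => ‖1 / (2 * Real.pi) * symbol c p (k * θ)‖ * ‖f (x - y)‖)
    (fun k => by
      refine MeasureTheory.AEStronglyMeasurable.mul (Continuous.aestronglyMeasurable (by fun_prop)) ?_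
      exact hfx.def'.aestronglyMeasurable)
    (fun k => Filter.Eventually.of_forall fun y _ => by
      rw [norm_mul, norm_mul _ (Complex.exp _),
        show Complex.I * k * y = ((k * y : ℝ) : ℂ) * Complex.I by push_cast; ring,
        Complex.norm_exp_ofReal_mul_I, mul_one])
    (Filter.Eventually.of_forall fun y _ => (hs.mul_left _).norm.mul_right _)
    (by
      simp_rw [tsum_mul_right]
      exact hfx.norm.const_mul _)
    (by
      -- Inversion is available only for `|y| < π`; the endpoint is a null set.
      filter_upwards [MeasureTheory.Measure.ae_ne MeasureTheory.volume Real.pi] with y hy hy'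
      rw [Set.uIoc_of_le (by linarith)] at hy'
      exact (hinv y (abs_lt.2 ⟨hy'.1, lt_of_le_of_ne hy'.2 hy⟩)).mul_right _)
  rw [integral_mollifier_mul_interval c p hθ hθ1 (fun y => f (x - y))] at key
  refine Eq.mp (congrArg (HasSum (L := .unconditional ℤ) · _) (funext fun k => ?_)) key
  symm
  have h1 : ∀ y : ℝ, 1 / (2 * Real.pi) * symbol c p (k * θ) * Complex.exp (Complex.I * k * y) *
      f (x - y) = 1 / (2 * Real.pi) * symbol c p (k * θ) * Complex.exp (Complex.I * k * x) *
      (f (x - y) * Complex.exp (-(Complex.I * k * ((x - y : ℝ) : ℂ)))) := fun y => by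
    have : Complex.exp (Complex.I * k * y) = Complex.exp (Complex.I * k * x) *
        Complex.exp (-(Complex.I * k * ((x - y : ℝ) : ℂ))) := by
      rw [← Complex.exp_add]; push_cast; ring_nf
    rw [this]
    ring
  simp_rw [h1]
  have hEper : Function.Periodic (fun z : ℝ => Complex.exp (-(Complex.I * k * z)))
      (2 * Real.pi) := fun z => by
    have : Complex.exp (-(Complex.I * k * ((z + 2 * Real.pi : ℝ) : ℂ))) =
        Complex.exp (-(Complex.I * k * z)) *
          Complex.exp (((-k : ℤ) : ℂ) * (2 * Real.pi * Complex.I)) := by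
      rw [← Complex.exp_add]; push_cast; ring_nf
    simp only
    rw [this, Complex.exp_int_mul_two_pi_mul_I, mul_one]
  have h2 := intervalIntegral.integral_comp_sub_left (a := -Real.pi) (b := Real.pi)
    (fun z : ℝ => f z * Complex.exp (-(Complex.I * k * z))) x
  have h3 := (hper.mul hEper).intervalIntegral_add_eq (x - Real.pi) (-Real.pi)
  rw [show -Real.pi + 2 * Real.pi = Real.pi by ring,
    show x - Real.pi + 2 * Real.pi = x - -Real.pi by ring] at h3
  simp only [Pi.mul_apply] at h3
  rw [intervalIntegral.integral_const_mul, h2, h3, fourierCoef]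
  ring

/-- By the symmetry `j ↦ -j`, pairing with `D_p` gives the `p`-th Fourier partial sum of `ρ_c F` at
`0`. Only the product is assumed continuous, since `F` may be singular at `±π`. -/
theorem integral_cutoff_mul_dirichletKernel (c : ℝ) (p : ℕ) {F : ℝ → ℂ}
    (hG : Continuous fun u => (cutoff c u : ℂ) * F u) :
    ∫ u in (-Real.pi)..Real.pi, cutoff c u * (dirichletKernel p u * F u) =
      ∑ j ∈ Finset.Icc (-(p : ℤ)) p, 1 / (2 * Real.pi) *
        ∫ u in (-Real.pi)..Real.pi, cutoff c u * F u * Complex.exp (-(Complex.I * j * u)) := by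
  have h1 : ∀ u : ℝ, (cutoff c u : ℂ) * (dirichletKernel p u * F u) =
      ∑ j ∈ Finset.Icc (-(p : ℤ)) p, 1 / (2 * Real.pi) *
        (cutoff c u * F u * Complex.exp (-(Complex.I * j * u))) := fun u => by
    have h2 : ∑ j ∈ Finset.Icc (-(p : ℤ)) p, Complex.exp (Complex.I * j * u) =
        ∑ j ∈ Finset.Icc (-(p : ℤ)) p, Complex.exp (-(Complex.I * j * u)) := by
      refine Finset.sum_nbij' (fun j => -j) (fun j => -j) ?_ ?_ ?_ ?_ ?_
      · intro j hj; simp at hj ⊢; omega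
      · intro j hj; simp at hj ⊢; omega
      · simp
      · simp
      · intro j _; push_cast; ring_nf
    rw [dirichletKernel, h2, ← Finset.mul_sum, ← Finset.mul_sum]
    ring
  simp_rw [h1]
  rw [intervalIntegral.integral_finsetSum fun j _ => by
    apply Continuous.intervalIntegrable; fun_prop]
  simp_rw [intervalIntegral.integral_const_mul]

theorem symbol_eq_sum {c : ℝ} (hc : 0 < c) (p : ℕ) (ξ : ℝ) :
    symbol c p ξ = ∑ j ∈ Finset.Icc (-(p : ℤ)) p, 1 / (2 * Real.pi) *
      ∫ u in (-Real.pi)..Real.pi, cutoff c u * 1 *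
        Complex.exp (-(Complex.I * ((ξ + j : ℝ) : ℂ) * u)) := by
  have hρ := continuous_cutoff hc
  have h1 := integral_cutoff_mul_dirichletKernel c p
    (F := fun u : ℝ => Complex.exp (-(Complex.I * ξ * u))) (by fun_prop)
  rw [symbol]
  simp_rw [mul_assoc (cutoff c _ : ℂ)]
  rw [h1]
  refine Finset.sum_congr rfl fun j _ => ?_
  congr 2 with u
  rw [mul_assoc, ← Complex.exp_add, one_mul]
  push_cast
  ring_nf

end SpectralMollifier

/-! ### Regularization and truncation errors -/

theorem Real.sqrt_le_sqrt_add_sqrt {x y b : ℝ} (hb : 0 ≤ b) (h : x ≤ y + b) : √x ≤ √y + √b := by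
  refine Real.sqrt_le_iff.2 ⟨by positivity, ?_⟩
  -- Also true for negative `y`, where `√y = 0`.
  have hy : y ≤ √y ^ 2 := by
    rcases le_total y 0 with hy | hy
    · exact hy.trans (sq_nonneg _)
    · exact (Real.sq_sqrt hy).ge
  nlinarith [Real.sq_sqrt hb, mul_nonneg (Real.sqrt_nonneg y) (Real.sqrt_nonneg b)]

theorem Real.exp_neg_le_factorial_div_pow {y : ℝ} (hy : 0 < y) (n : ℕ) :
    Real.exp (-y) ≤ n.factorial / y ^ n := by
  have h := Real.pow_div_factorial_le_exp y hy.le n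
  rw [Real.exp_neg, ← inv_div]
  exact inv_anti₀ (by positivity) h

namespace SpectralMollifier

theorem exists_norm_regularization_le {c r : ℝ} (hc : 0 < c) (hr : 0 < r) :
    ∃ a > 0, ∃ C > 0, ∀ (h : ℕ → ℝ → ℂ) (K : ℝ),
      (∀ k u, |u| < Real.pi → HasDerivAt (h k) (h (k + 1) u) u) →
      (∀ k u, |u| < Real.pi → ‖h k u‖ ≤ K * k.factorial / r ^ k) → ∀ p : ℕ,
      ‖(∫ u in (-Real.pi)..Real.pi, cutoff c u * (dirichletKernel p u * h 0 u)) - h 0 0‖ ≤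
        C * K * Real.exp (-(a * √p)) := by
  have hπ := Real.pi_pos
  obtain ⟨a, ha, C, hC, hbound⟩ := exists_norm_integral_cutoff_mul_le hc hr
  refine ⟨a / 2, by positivity, 4 * (C * (24 / (a / 2) ^ 4)), by positivity,
    fun h K hd hM p => ?_⟩
  have hK : 0 ≤ K := by
    have := (norm_nonneg _).trans (hM 0 0 (by simp [Real.pi_pos]))
    simpa using this
  have hG := continuous_cutoff_mul hc hd hM
  set u : ℤ → ℂ := fun j => 1 / (2 * Real.pi) *
    ∫ u in (-Real.pi)..Real.pi, cutoff c u * h 0 u * Complex.exp (-(Complex.I * j * u)) with hu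
  have hub : ∀ j : ℤ, (p : ℤ) < |j| →
      ‖u j‖ ≤ C * K * (24 / (a / 2) ^ 4) * Real.exp (-(a / 2 * √p)) / (j : ℝ) ^ 2 := fun j hj => by
    have hj' : (p : ℝ) < |(j : ℝ)| := by exact_mod_cast hj
    have hj0 : 0 < |(j : ℝ)| := (Nat.cast_nonneg p).trans_lt hj'
    have h1 := hbound h K hd hM j
    simp only [Complex.ofReal_intCast] at h1
    have h2 : ‖(1 / (2 * Real.pi) : ℂ)‖ ≤ 1 := by
      rw [show (1 / (2 * Real.pi) : ℂ) = ((1 / (2 * Real.pi) : ℝ) : ℂ) by push_cast; rfl,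
        Complex.norm_real, Real.norm_eq_abs, abs_of_pos (by positivity), div_le_one (by positivity)]
      linarith [Real.pi_gt_three]
    -- Half of the exponent is kept as decay in `√p`; the other half pays for `1 / j²`, through
    -- `exp(-y) ≤ 4! / y⁴`.
    have h3 : Real.exp (-(a * √|(j : ℝ)|)) ≤
        Real.exp (-(a / 2 * √p)) * (24 / ((a / 2) ^ 4 * (j : ℝ) ^ 2)) := by
      rw [show -(a * √|(j : ℝ)|) = -(a / 2 * √|(j : ℝ)|) + -(a / 2 * √|(j : ℝ)|) by ring,
        Real.exp_add]
      gcongr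
      refine (Real.exp_neg_le_factorial_div_pow (by positivity) 4).trans_eq ?_
      rw [mul_pow, show √|(j : ℝ)| ^ 4 = (√|(j : ℝ)| ^ 2) ^ 2 by ring, Real.sq_sqrt hj0.le, sq_abs]
      norm_num [Nat.factorial]
    rw [hu, norm_mul]
    calc _ ≤ 1 * (C * K * (Real.exp (-(a / 2 * √p)) * (24 / ((a / 2) ^ 4 * (j : ℝ) ^ 2)))) := by
          gcongr
          exact h1.trans (by gcongr)
      _ = _ := by
          have : (j : ℝ) ≠ 0 := abs_pos.1 hj0
          field_simp
  obtain ⟨hs, htail⟩ := norm_tsum_sub_sum_Icc_le (by positivity) hub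
  have hinv := hasSum_fourier_of_summable hG (by
    rw [cutoff_of_pi_le_abs c (by simp [abs_of_pos hπ]), cutoff_of_pi_le_abs c (by simp [abs_of_pos hπ])]
    simp) hs (x := 0) (by simpa using hπ)
  simp only [Complex.ofReal_zero, mul_zero, Complex.exp_zero, mul_one, cutoff_zero,
    Complex.ofReal_one, one_mul] at hinv
  rw [integral_cutoff_mul_dirichletKernel c p hG, norm_sub_rev, ← hinv.tsum_eq]
  refine htail.trans ?_
  calc _ ≤ 4 * (C * K * (24 / (a / 2) ^ 4) * Real.exp (-(a / 2 * √p))) / 1 := by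
        gcongr
        linarith [(Nat.cast_nonneg p : (0 : ℝ) ≤ p)]
    _ = _ := by ring

/-- Each of the `2p + 1` frequencies `ξ + j` has size at least `|ξ| - p`. When that is negative the
square root is `0` and the bound is still valid. -/
theorem exists_norm_symbol_le {c : ℝ} (hc : 0 < c) :
    ∃ a > 0, ∃ C > 0, ∀ (p : ℕ) (ξ : ℝ),
      ‖symbol c p ξ‖ ≤ C * (2 * p + 1) * Real.exp (-(a * √(|ξ| - p))) := by
  have hπ := Real.pi_pos
  obtain ⟨a, ha, C, hC, hbound⟩ := exists_norm_integral_cutoff_mul_le hc one_pos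
  -- The analytic factor is the constant `1`, with all higher derivatives zero.
  have hb := hbound (fun k _ => if k = 0 then 1 else 0) 1
    (fun k u _ => by simpa using hasDerivAt_const u (if k = 0 then (1 : ℂ) else 0))
    (fun k u _ => by
      have : (1 : ℝ) ≤ k.factorial := by exact_mod_cast k.factorial_pos
      split_ifs <;> simp [this])
  simp only [if_true] at hb
  refine ⟨a, ha, C, hC, fun p ξ => ?_⟩
  rw [symbol_eq_sum hc]
  refine (norm_sum_le_of_le (f := fun j : ℤ => 1 / (2 * Real.pi) *
      ∫ u in (-Real.pi)..Real.pi, cutoff c u * 1 *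
        Complex.exp (-(Complex.I * ((ξ + j : ℝ) : ℂ) * u))) _
    (n := fun _ => C * Real.exp (-(a * √(|ξ| - p)))) fun j hj => ?_).trans_eq ?_
  · have h2 : ‖(1 / (2 * Real.pi) : ℂ)‖ ≤ 1 := by
      rw [show (1 / (2 * Real.pi) : ℂ) = ((1 / (2 * Real.pi) : ℝ) : ℂ) by push_cast; rfl,
        Complex.norm_real, Real.norm_eq_abs, abs_of_pos (by positivity), div_le_one (by positivity)]
      linarith [Real.pi_gt_three]
    have hj' : |(j : ℝ)| ≤ p := by
      rw [Finset.mem_Icc, ← abs_le] at hj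
      exact_mod_cast hj
    have h3 : |ξ| - p ≤ |ξ + j| := by
      have := abs_sub_abs_le_abs_sub ξ (-j)
      rw [abs_neg, sub_neg_eq_add] at this
      linarith
    rw [norm_mul]
    calc _ ≤ 1 * (C * 1 * Real.exp (-(a * √|ξ + j|))) := by
          gcongr
          exact hb (ξ + j)
      _ ≤ _ := by
          rw [one_mul, mul_one]
          gcongr
  · rw [Finset.sum_const, Int.card_Icc, nsmul_eq_mul,
      show ((p : ℤ) + 1 - -p).toNat = 2 * p + 1 by omega]
    push_cast
    ring

theorem exists_norm_truncation_le {c : ℝ} (hc : 0 < c) :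
    ∃ a > 0, ∃ C > 0, ∀ f : ℝ → ℂ, Function.Periodic f (2 * Real.pi) →
      (∀ a b, IntervalIntegrable f MeasureTheory.volume a b) →
      BoundedVariationOn f (Set.Icc 0 (2 * Real.pi)) →
      ∀ (θ x l B : ℝ) (N p : ℕ), 0 < θ → θ ≤ 1 → 0 < l → 0 ≤ B → 0 < N →
        (∀ t : ℝ, N ≤ t → l * (t * θ) ≤ t * θ - p + B) →
        ‖recovered c p θ N f x -
          ∫ u in (-Real.pi)..Real.pi, cutoff c u * (dirichletKernel p u * f (x - θ * u))‖ ≤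
        C * (2 * p + 1) * Real.exp (a * √B) / (l * (θ * N)) *
          (eVariationOn f (Set.Icc 0 (2 * Real.pi))).toReal *
            Real.exp (-(a / 2 * √l * √(θ * N))) := by
  obtain ⟨a, ha, C, hC, hsym⟩ := exists_norm_symbol_le hc
  refine ⟨a, ha, 4 * (C * (2 / (a / 2) ^ 2)), by positivity,
    fun f hper hint hbv θ x l B N p hθ hθ1 hl hB hN hgap => ?_⟩
  set V := (eVariationOn f (Set.Icc 0 (2 * Real.pi))).toReal
  have hV : 0 ≤ V := ENNReal.toReal_nonneg
  have hN' : (0 : ℝ) < N := by exact_mod_cast hN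
  have hsymk : ∀ k : ℤ, (N : ℤ) < |k| → ‖symbol c p (k * θ)‖ ≤
      C * (2 * p + 1) * (Real.exp (a * √B) * Real.exp (-(a * √l * √(|(k : ℝ)| * θ)))) :=
    fun k hk => by
      have hk' : (N : ℝ) < |(k : ℝ)| := by exact_mod_cast hk
      refine (hsym p _).trans ?_
      rw [← Real.exp_add]
      gcongr
      have h1 := Real.sqrt_le_sqrt_add_sqrt hB (hgap _ hk'.le)
      rw [Real.sqrt_mul hl.le] at h1
      rw [abs_mul, abs_of_pos hθ]
      have := mul_le_mul_of_nonneg_left h1 ha.le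
      linarith
  -- Without the `1/|k|` of the coefficients, the exponential alone must supply `1/k²`; hence the
  -- fourth power here and the second power in the tail bound `hub`.
  have hsum : Summable fun k : ℤ => symbol c p (k * θ) := by
    refine (norm_tsum_sub_sum_Icc_le (N := N) (b := C * (2 * p + 1) * (Real.exp (a * √B) *
      (24 / ((a * √l) ^ 4 * θ ^ 2)))) (by positivity) fun k hk => ?_).1
    have hk' : (N : ℝ) < |(k : ℝ)| := by exact_mod_cast hk
    have hk0 : 0 < |(k : ℝ)| := hN'.trans hk'
    refine (hsymk k hk).trans ?_
    have h1 : Real.exp (-(a * √l * √(|(k : ℝ)| * θ))) ≤ 24 / ((a * √l) ^ 4 * θ ^ 2) / (k : ℝ) ^ 2 := by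
      refine (Real.exp_neg_le_factorial_div_pow (by positivity) 4).trans_eq ?_
      rw [mul_pow (a * √l), show √(|(k : ℝ)| * θ) ^ 4 = (√(|(k : ℝ)| * θ) ^ 2) ^ 2 by ring,
        Real.sq_sqrt (by positivity), mul_pow _ θ, sq_abs]
      norm_num [Nat.factorial]
      field_simp
    rw [mul_div_assoc, mul_div_assoc]
    gcongr
  have hhs := hasSum_fourierCoef_mul_symbol hc p hθ hθ1 hper hint x hsum
  have hub : ∀ k : ℤ, (N : ℤ) < |k| →
      ‖fourierCoef f k * Complex.exp (Complex.I * k * x) * symbol c p (k * θ)‖ ≤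
      C * (2 * p + 1) * Real.exp (a * √B) * V * Real.exp (-(a / 2 * √l * √(θ * N))) *
        (2 / ((a / 2) ^ 2 * l * θ)) / (k : ℝ) ^ 2 := fun k hk => by
    have hk' : (N : ℝ) < |(k : ℝ)| := by exact_mod_cast hk
    have hk0 : 0 < |(k : ℝ)| := hN'.trans hk'
    have hkne : k ≠ 0 := by rintro rfl; simp at hk0
    rw [norm_mul, norm_mul, show Complex.I * k * x = ((k * x : ℝ) : ℂ) * Complex.I by push_cast; ring,
      Complex.norm_exp_ofReal_mul_I, mul_one]
    have h1 : Real.exp (-(a * √l * √(|(k : ℝ)| * θ))) ≤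
        Real.exp (-(a / 2 * √l * √(θ * N))) * (2 / ((a / 2) ^ 2 * l * θ * |(k : ℝ)|)) := by
      rw [show -(a * √l * √(|(k : ℝ)| * θ)) = -(a / 2 * √l * √(|(k : ℝ)| * θ)) +
        -(a / 2 * √l * √(|(k : ℝ)| * θ)) by ring, Real.exp_add]
      gcongr ?_ * ?_
      · refine Real.exp_le_exp.2 (neg_le_neg
          (mul_le_mul_of_nonneg_left (Real.sqrt_le_sqrt ?_) (by positivity)))
        rw [mul_comm]
        gcongr
      · refine (Real.exp_neg_le_factorial_div_pow (by positivity) 2).trans_eq ?_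
        rw [mul_pow, mul_pow, Real.sq_sqrt hl.le, Real.sq_sqrt (by positivity)]
        norm_num [Nat.factorial]
        ring
    calc _ ≤ V / |(k : ℝ)| * (C * (2 * p + 1) * (Real.exp (a * √B) *
          (Real.exp (-(a / 2 * √l * √(θ * N))) * (2 / ((a / 2) ^ 2 * l * θ * |(k : ℝ)|))))) := by
          refine mul_le_mul (norm_fourierCoef_le hper hint hbv hkne) ((hsymk k hk).trans ?_)
            (norm_nonneg _) (by positivity)
          gcongr
      _ = _ := by
          rw [← sq_abs (k : ℝ)]
          field_simp
  have htail := (norm_tsum_sub_sum_Icc_le (by positivity) hub).2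
  rw [hhs.tsum_eq, ← recovered_eq_sum hc p hθ, norm_sub_rev] at htail
  refine htail.trans ?_
  calc _ ≤ 4 * (C * (2 * p + 1) * Real.exp (a * √B) * V * Real.exp (-(a / 2 * √l * √(θ * N))) *
        (2 / ((a / 2) ^ 2 * l * θ))) / N := by
        gcongr
        linarith
    _ = _ := by
        field_simp

theorem exists_norm_recovered_sub_le {c κ r : ℝ} (hc : 0 < c) (hκ : 0 < κ) (hκ1 : κ < 1)
    (hr : 0 < r) :
    ∃ a > 0, ∃ ε > 0, ∀ δ > 0, ∀ B : ℝ, ∃ C > 0, ∀ f : ℝ → ℂ,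
      Function.Periodic f (2 * Real.pi) →
      (∀ a b, IntervalIntegrable f MeasureTheory.volume a b) →
      BoundedVariationOn f (Set.Icc 0 (2 * Real.pi)) →
      ∀ (θ x K : ℝ) (h : ℕ → ℝ → ℂ), 0 < θ → θ ≤ 1 → (∀ u, h 0 u = f (x - θ * u)) →
      (∀ k u, |u| < Real.pi → HasDerivAt (h k) (h (k + 1) u) u) →
      (∀ k u, |u| < Real.pi → ‖h k u‖ ≤ K * k.factorial / r ^ k) →
      ∀ N p : ℕ, δ ≤ θ * N → |(p : ℝ) - κ * (θ * N)| ≤ ε * (θ * N) + B →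
        ‖recovered c p θ N f x - f x‖ ≤
          C * (K + (eVariationOn f (Set.Icc 0 (2 * Real.pi))).toReal) * (θ * N) *
            Real.exp (-(a * √(θ * N))) := by
  obtain ⟨a₁, ha₁, C₁, hC₁, hreg⟩ := exists_norm_regularization_le hc hr
  obtain ⟨a₂, ha₂, C₂, hC₂, htrunc⟩ := exists_norm_truncation_le hc
  -- With `ε = min (κ/2) l`, the condition on `p` gives both `p ≥ (κ/2) X - |B|` and `X - p ≥ l X -
  -- |B|`, where `X = θN`.
  set l := (1 - κ) / 2 with hl
  have hl0 : 0 < l := by rw [hl]; linarith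
  refine ⟨min (a₁ * √(κ / 2)) (a₂ / 2 * √l), by positivity, min (κ / 2) l, by positivity,
    fun δ hδ B => ?_⟩
  -- The shift `B` costs `exp(a√|B|)`. The division by `δ` creates the factor `X ≥ δ` of the
  -- conclusion, as `(2p + 1)/X` is already bounded.
  set M₁ := C₁ * Real.exp (a₁ * √|B|) / δ
  set M₂ := C₂ * Real.exp (a₂ * √|B|) * (2 + (2 * |B| + 1) / δ) / l / δ
  have hM₁ : 0 < M₁ := by positivity
  have hM₂ : 0 < M₂ := by positivity
  refine ⟨M₁ + M₂, by positivity, fun f hper hint hbv θ x K h hθ hθ1 h0 hd hM N p hX hp => ?_⟩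
  set V := (eVariationOn f (Set.Icc 0 (2 * Real.pi))).toReal
  have hV : 0 ≤ V := ENNReal.toReal_nonneg
  have hK : 0 ≤ K := by
    have := (norm_nonneg _).trans (hM 0 0 (by simp [Real.pi_pos]))
    simpa using this
  set X := θ * N with hXdef
  have hX0 : 0 < X := hδ.trans_le hX
  set a := min (a₁ * √(κ / 2)) (a₂ / 2 * √l)
  rw [abs_le] at hp
  have hBabs := le_abs_self B
  have he1 : min (κ / 2) l * X ≤ κ / 2 * X := by gcongr; exact min_le_left _ _
  have he2 : min (κ / 2) l * X ≤ l * X := by gcongr; exact min_le_right _ _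
  have hN : 0 < N := by
    rcases Nat.eq_zero_or_pos N with rfl | h
    · simp [hXdef] at hX0
    · exact h
  have hR : ‖(∫ u in (-Real.pi)..Real.pi, cutoff c u * (dirichletKernel p u * f (x - θ * u))) -
      f x‖ ≤ M₁ * K * X * Real.exp (-(a * √X)) := by
    have h1 := hreg h K hd hM p
    simp only [h0, mul_zero, sub_zero] at h1
    refine h1.trans ?_
    have h2 : √(κ / 2) * √X ≤ √p + √|B| := by
      rw [← Real.sqrt_mul (by positivity)]
      exact Real.sqrt_le_sqrt_add_sqrt (abs_nonneg B) (by linarith)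
    have h3 : Real.exp (-(a₁ * √p)) ≤ Real.exp (a₁ * √|B|) * Real.exp (-(a * √X)) := by
      rw [← Real.exp_add]
      gcongr
      have h4 : a * √X ≤ a₁ * √(κ / 2) * √X := by gcongr; exact min_le_left _ _
      have := mul_le_mul_of_nonneg_left h2 ha₁.le
      linarith
    calc _ ≤ C₁ * K * (Real.exp (a₁ * √|B|) * Real.exp (-(a * √X))) := by gcongr
      _ = M₁ * K * δ * Real.exp (-(a * √X)) := by simp only [M₁]; field_simp
      _ ≤ _ := by gcongr
  have hT : ‖recovered c p θ N f x -
      ∫ u in (-Real.pi)..Real.pi, cutoff c u * (dirichletKernel p u * f (x - θ * u))‖ ≤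
      M₂ * V * X * Real.exp (-(a * √X)) := by
    refine (htrunc f hper hint hbv θ x l |B| N p hθ hθ1 hl0 (abs_nonneg B) hN fun t ht => ?_).trans ?_
    · have h1 : X ≤ t * θ := by rw [hXdef, mul_comm]; gcongr
      have h2 : (1 - l) * X ≤ (1 - l) * (t * θ) := by gcongr; rw [hl]; linarith
      have h3 : (1 - l) * X = κ * X + l * X := by rw [hl]; ring
      linarith
    · have h1 : (2 * p + 1 : ℝ) ≤ (2 + (2 * |B| + 1) / δ) * X := by
        have h3 : (2 * |B| + 1) ≤ (2 * |B| + 1) / δ * X := by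
          rw [div_mul_eq_mul_div, le_div_iff₀ hδ]
          gcongr
        have h4 : κ * X + l * X ≤ 1 * X := by rw [← add_mul]; gcongr; rw [hl]; linarith
        linarith
      have h2 : Real.exp (-(a₂ / 2 * √l * √X)) ≤ Real.exp (-(a * √X)) := by
        gcongr
        exact min_le_right _ _
      calc _ ≤ C₂ * ((2 + (2 * |B| + 1) / δ) * X) * Real.exp (a₂ * √|B|) / (l * X) * V *
            Real.exp (-(a * √X)) := by gcongr
        _ = M₂ * V * δ * Real.exp (-(a * √X)) := by simp only [M₂]; field_simp
        _ ≤ _ := by gcongr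
  calc _ ≤ _ := norm_sub_le_norm_sub_add_norm_sub _
        (∫ u in (-Real.pi)..Real.pi, cutoff c u * (dirichletKernel p u * f (x - θ * u))) _
    _ ≤ M₂ * V * X * Real.exp (-(a * √X)) + M₁ * K * X * Real.exp (-(a * √X)) := add_le_add hT hR
    _ = (M₁ * K + M₂ * V) * X * Real.exp (-(a * √X)) := by ring
    _ ≤ _ := by
      gcongr
      nlinarith [mul_nonneg hM₁.le hV, mul_nonneg hM₂.le hK]

end SpectralMollifier

/-! ### Uniform Cauchy estimates for analytic functions -/

/-- Re-expansion at `x` times `r^k` is dominated by the terms of fixed `k` in a double series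
independent of `x`, which converges because `2r` is below the radius; its total sum is `T`. -/
theorem FormalMultilinearSeries.exists_norm_changeOrigin_le {E F : Type*} [NormedAddCommGroup E]
    [NormedSpace ℝ E] [NormedAddCommGroup F] [NormedSpace ℝ F]
    (p : FormalMultilinearSeries ℝ E F) {r : NNReal} (hr : 0 < r)
    (hp : (r + r : ENNReal) < p.radius) :
    ∃ T : ℝ, ∀ x : E, ‖x‖ ≤ r → ∀ k, ‖p.changeOrigin x k‖ ≤ T / (r : ℝ) ^ k := by
  let G : (Σ k l : ℕ, { s : Finset (Fin (k + l)) // s.card = l }) → NNReal := fun s =>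
    ‖p (s.1 + s.2.1)‖₊ * r ^ s.2.1 * r ^ s.1
  have hs : Summable G := p.changeOriginSeries_summable_aux₁ hp
  refine ⟨(∑' s, G s : NNReal), fun x hx k => ?_⟩
  have hx' : ‖x‖₊ ≤ r := by exact_mod_cast hx
  have hrad : (r : ENNReal) < p.radius := lt_of_le_of_lt le_self_add hp
  have hxr : (‖x‖₊ : ENNReal) < p.radius := lt_of_le_of_lt (by exact_mod_cast hx') hrad
  have h1 := p.nnnorm_changeOrigin_le k hxr
  have h2 : (∑' s : Σ l : ℕ, { s : Finset (Fin (k + l)) // s.card = l },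
      ‖p (k + s.1)‖₊ * ‖x‖₊ ^ s.1) ≤ ∑' s : Σ l : ℕ, { s : Finset (Fin (k + l)) // s.card = l },
      ‖p (k + s.1)‖₊ * r ^ s.1 :=
    Summable.tsum_le_tsum (fun s => by gcongr) (p.changeOriginSeries_summable_aux₂ hxr k)
      (p.changeOriginSeries_summable_aux₂ hrad k)
  have h3 : (∑' s : Σ l : ℕ, { s : Finset (Fin (k + l)) // s.card = l },
      ‖p (k + s.1)‖₊ * r ^ s.1) * r ^ k ≤ ∑' s, G s := by
    rw [← NNReal.tsum_mul_right]
    exact NNReal.tsum_comp_le_tsum_of_inj (f := G) hs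
      (i := fun s : Σ l : ℕ, { s : Finset (Fin (k + l)) // s.card = l } => ⟨k, s⟩)
      (fun a b hab => eq_of_heq (Sigma.mk.inj_iff.1 hab).2)
  rw [le_div_iff₀ (by positivity)]
  have h4 : ‖p.changeOrigin x k‖₊ * r ^ k ≤ ∑' s, G s :=
    (mul_le_mul_left (h1.trans h2) (r ^ k)).trans h3
  exact_mod_cast h4

/-- Uniform Cauchy estimates on `s`. -/
def HasCauchyBoundOn (g : ℝ → ℂ) (s : Set ℝ) : Prop :=
  ∃ K ≥ 0, ∃ r > 0, ∀ y ∈ s, ∀ k : ℕ, ‖iteratedDeriv k g y‖ ≤ K * k.factorial / r ^ k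

theorem HasCauchyBoundOn.mono {g : ℝ → ℂ} {s t : Set ℝ} (h : HasCauchyBoundOn g t) (hst : s ⊆ t) :
    HasCauchyBoundOn g s := by
  obtain ⟨K, hK, r, hr, h⟩ := h
  exact ⟨K, hK, r, hr, fun y hy => h y (hst hy)⟩

theorem HasCauchyBoundOn.empty (g : ℝ → ℂ) : HasCauchyBoundOn g ∅ :=
  ⟨0, le_rfl, 1, one_pos, fun _ h => h.elim⟩

theorem HasCauchyBoundOn.union {g : ℝ → ℂ} {s t : Set ℝ} (hs : HasCauchyBoundOn g s)
    (ht : HasCauchyBoundOn g t) : HasCauchyBoundOn g (s ∪ t) := by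
  obtain ⟨K, hK, r, hr, h⟩ := hs
  obtain ⟨K', hK', r', hr', h'⟩ := ht
  have hm : 0 < min r r' := lt_min hr hr'
  refine ⟨max K K', le_max_of_le_left hK, min r r', hm, ?_⟩
  rintro y (hy | hy) k
  · refine (h y hy k).trans ?_
    gcongr
    · exact le_max_left _ _
    · exact min_le_left _ _
  · refine (h' y hy k).trans ?_
    gcongr
    · exact le_max_right _ _
    · exact min_le_right _ _

theorem AnalyticAt.exists_hasCauchyBoundOn {g : ℝ → ℂ} {z : ℝ} (hg : AnalyticAt ℝ g z) :
    ∃ t ∈ nhds z, HasCauchyBoundOn g t := by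
  obtain ⟨p, R, hp⟩ := hg
  obtain ⟨q, hq0, hqR⟩ := ENNReal.lt_iff_exists_nnreal_btwn.1 hp.r_pos
  have hq0' : 0 < q := by exact_mod_cast hq0
  set r : NNReal := q / 2
  have hr : 0 < r := by positivity
  have hrr : (r + r : ENNReal) < R := by
    have : r + r = q := add_halves q
    rw [← ENNReal.coe_add, this]
    exact hqR
  obtain ⟨T, hT⟩ := p.exists_norm_changeOrigin_le hr (hrr.trans_le hp.r_le)
  refine ⟨Metric.ball z r, Metric.ball_mem_nhds _ (by exact_mod_cast hr), |T|, abs_nonneg _, r,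
    by exact_mod_cast hr, fun y hy k => ?_⟩
  have hyz : ‖y - z‖ < r := by rwa [Metric.mem_ball, dist_eq_norm] at hy
  have hyz' : ((‖y - z‖₊ : NNReal) : ENNReal) < R :=
    lt_of_lt_of_le (by exact_mod_cast hyz) (le_self_add.trans hrr.le)
  have hc := hp.changeOrigin hyz'
  rw [add_sub_cancel] at hc
  have h1 := hc.factorial_smul (1 : ℝ) k
  rw [iteratedDeriv_eq_iteratedFDeriv, ← h1, nsmul_eq_mul, norm_mul, Complex.norm_natCast]
  have h2 := (p.changeOrigin (y - z) k).le_opNorm (fun _ => (1 : ℝ))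
  simp only [norm_one, Finset.prod_const_one, mul_one] at h2
  calc _ ≤ (k.factorial : ℝ) * (|T| / (r : ℝ) ^ k) := by
        gcongr
        refine h2.trans ((hT _ hyz.le k).trans ?_)
        gcongr
        exact le_abs_self T
    _ = _ := by ring

theorem AnalyticOnNhd.hasCauchyBoundOn {g : ℝ → ℂ} {s : Set ℝ} (hg : AnalyticOnNhd ℝ g s)
    (hs : IsCompact s) : HasCauchyBoundOn g s :=
  hs.induction_on (p := HasCauchyBoundOn g) (HasCauchyBoundOn.empty g) (fun _ _ hst h => h.mono hst)
    (fun _ _ h h' => h.union h') fun z hz => by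
      obtain ⟨t, ht, h⟩ := (hg z hz).exists_hasCauchyBoundOn
      exact ⟨t, mem_nhdsWithin_of_mem_nhds ht, h⟩

theorem ContDiffAt.hasDerivAt_iteratedDeriv {f : ℝ → ℂ} {y : ℝ} (hf : ContDiffAt ℝ ∞ f y) (k : ℕ) :
    HasDerivAt (iteratedDeriv k f) (iteratedDeriv (k + 1) f y) y := by
  rw [iteratedDeriv_succ]
  have h : ContDiffAt ℝ 1 (iteratedFDeriv ℝ k f) y :=
    hf.iteratedFDeriv_right (by exact_mod_cast le_top)
  have h2 : DifferentiableAt ℝ (iteratedDeriv k f) y := by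
    rw [iteratedDeriv_eq_equiv_comp]
    exact (LinearIsometryEquiv.differentiable _).differentiableAt.comp y
      (h.differentiableAt (by norm_num))
  exact h2.hasDerivAt

/-! ### Singular support and passage to `f` -/

namespace SpectralMollifier

theorem contDiffAt_of_notMem_singSupp {f : ℝ → ℂ} {y : ℝ} (hy : y ∉ singSupp f) :
    ContDiffAt ℝ ∞ f y := by
  simp only [singSupp, Set.mem_ofPred_eq, not_not] at hy
  obtain ⟨U, hU, hyU, hf⟩ := hy
  exact hf.contDiffAt (hU.mem_nhds hyU)

theorem add_mem_singSupp {f : ℝ → ℂ} {T : ℝ} (hper : Function.Periodic f T) {y : ℝ}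
    (hy : y ∈ singSupp f) : y + T ∈ singSupp f := by
  rintro ⟨U, hU, hyU, hf⟩
  refine hy ⟨(fun z => z + T) ⁻¹' U, hU.preimage (by fun_prop), hyU, ?_⟩
  have h := hf.comp (g := f) (f := fun z : ℝ => z + T) (s := (fun z => z + T) ⁻¹' U)
    (by fun_prop) (fun z hz => hz)
  exact h.congr fun z _ => (hper z).symm

/-- The singular support is invariant under translation by `2π`, so one of the translates of a
singular point lies within `π` of `x`. -/
theorem theta_le_one {f : ℝ → ℂ} (hper : Function.Periodic f (2 * Real.pi))
    (hne : (singSupp f).Nonempty) (x : ℝ) : theta f x ≤ 1 := by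
  have hπ := Real.pi_pos
  obtain ⟨s, hs⟩ := hne
  set m : ℤ := round ((x - s) / (2 * Real.pi))
  have hm : s + m * (2 * Real.pi) ∈ singSupp f :=
    add_mem_singSupp (by simpa using hper.int_mul m) hs
  rw [theta, div_le_one hπ]
  refine (Metric.infDist_le_dist_of_mem hm).trans ?_
  have h1 := abs_sub_round ((x - s) / (2 * Real.pi))
  rw [Real.dist_eq, show x - (s + m * (2 * Real.pi)) =
    ((x - s) / (2 * Real.pi) - m) * (2 * Real.pi) by field_simp; ring, abs_mul,
    abs_of_pos Real.two_pi_pos]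
  nlinarith

theorem IsPiecewiseAnalytic.hasCauchyBoundOn {f : ℝ → ℂ}
    (hper : Function.Periodic f (2 * Real.pi)) (hf : IsPiecewiseAnalytic f) :
    HasCauchyBoundOn f (singSupp f)ᶜ := by
  obtain ⟨n, t, hlt, htn, hg⟩ := hf
  have hpi : ∀ i < n, HasCauchyBoundOn f (Set.Icc (t i) (t (i + 1)) \ singSupp f) := fun i hi => by
    obtain ⟨g, hga, hfg⟩ := hg i hi
    obtain ⟨K, hK, r, hr, h⟩ := hga.hasCauchyBoundOn isCompact_Icc
    refine ⟨K, hK, r, hr, fun y hy k => ?_⟩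
    -- At a break point where `f` is smooth, the bound passes to the limit from the open piece.
    have hcont := ((contDiffAt_of_notMem_singSupp hy.2).hasDerivAt_iteratedDeriv k).continuousAt
    have hcl : y ∈ closure (Set.Ioo (t i) (t (i + 1))) := by
      rw [closure_Ioo (hlt i hi).ne]
      exact hy.1
    have := mem_closure_iff_nhdsWithin_neBot.1 hcl
    refine le_of_tendsto (hcont.norm.tendsto.mono_left
      (nhdsWithin_le_nhds (s := Set.Ioo (t i) (t (i + 1))))) ?_
    filter_upwards [self_mem_nhdsWithin] with z hz
    rw [(Filter.eventuallyEq_of_mem (isOpen_Ioo.mem_nhds hz) hfg).iteratedDeriv_eq]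
    exact h z (Set.Ioo_subset_Icc_self hz) k
  have hall : ∀ m ≤ n, t 0 ≤ t m ∧ HasCauchyBoundOn f (Set.Ico (t 0) (t m) \ singSupp f) := fun m => by
    induction m with
    | zero => intro _; simpa using HasCauchyBoundOn.empty f
    | succ m ih =>
      intro hm
      obtain ⟨h1, h2⟩ := ih (by omega)
      refine ⟨h1.trans (hlt m (by omega)).le, (h2.union (hpi m (by omega))).mono ?_⟩
      rw [← Set.union_sdiff_distrib]
      refine Set.sdiff_subset_sdiff_left fun y hy => ?_
      rcases lt_or_ge y (t m) with h | h
      · exact .inl ⟨hy.1, h⟩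
      · exact .inr ⟨h, hy.2.le⟩
  obtain ⟨K, hK, r, hr, h⟩ := (hall n le_rfl).2
  refine ⟨K, hK, r, hr, fun y hy k => ?_⟩
  obtain ⟨m, hm, -⟩ := existsUnique_add_zsmul_mem_Ico Real.two_pi_pos y (t 0)
  have hTper : Function.Periodic f (m • (2 * Real.pi)) := hper.zsmul m
  have hy' : y + m • (2 * Real.pi) ∉ singSupp f := fun hmem => hy (by
    simpa using add_mem_singSupp hTper.neg hmem)
  rw [← htn] at hm
  have hb := h _ ⟨hm, hy'⟩ k
  have hiter : iteratedDeriv k f (y + m • (2 * Real.pi)) = iteratedDeriv k f y := by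
    have h1 := congrFun (iteratedDeriv_comp_add_const k f (m • (2 * Real.pi))) y
    rw [← h1]
    congr 1
    exact funext hTper
  rwa [hiter] at hb

theorem exists_norm_recovered_theta_sub_le {c κ r : ℝ} (hc : 0 < c) (hκ : 0 < κ) (hκ1 : κ < 1)
    (hr : 0 < r) :
    ∃ a > 0, ∃ ε > 0, ∀ δ > 0, ∀ B : ℝ, ∃ C > 0, ∀ f : ℝ → ℂ,
      Function.Periodic f (2 * Real.pi) → IsPiecewiseAnalytic f → (singSupp f).Nonempty →
      ∀ (x K : ℝ),
        (∀ y : ℝ, |y - x| < Metric.infDist x (singSupp f) →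
          ∀ s : ℕ, ‖iteratedDeriv s f y‖ ≤ K * s.factorial / r ^ s) →
      ∀ N p : ℕ,
        δ ≤ theta f x * N →
        |(p : ℝ) - κ * (theta f x * N)| ≤ ε * (theta f x * N) + B →
        ‖recovered c p (theta f x) N f x - f x‖ ≤
          C * (K + (eVariationOn f (Set.Icc 0 (2 * Real.pi))).toReal) * (theta f x * N) *
            Real.exp (-(a * √(theta f x * N))) := by
  have hπ := Real.pi_pos
  obtain ⟨a, ha, ε, hε, hmain⟩ := exists_norm_recovered_sub_le hc hκ hκ1 hr
  refine ⟨a, ha, ε, hε, fun δ hδ B => ?_⟩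
  obtain ⟨C, hC, hmain⟩ := hmain δ hδ B
  refine ⟨C, hC, fun f hper hf hne x K hb N p hX hp => ?_⟩
  have hθ1 := theta_le_one hper hne x
  have hθ0 : 0 ≤ theta f x := div_nonneg Metric.infDist_nonneg hπ.le
  have hθd : theta f x * Real.pi = Metric.infDist x (singSupp f) := by
    rw [theta, div_mul_cancel₀ _ hπ.ne']
  have hθ : 0 < theta f x := by
    refine lt_of_le_of_ne hθ0 fun h => ?_
    rw [← h, zero_mul] at hX
    linarith
  generalize theta f x = θ at *
  have hnear : ∀ u : ℝ, |u| < Real.pi →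
      |x - θ * u - x| < Metric.infDist x (singSupp f) := fun u hu => by
    rw [← hθd, show x - θ * u - x = -(θ * u) by ring, abs_neg, abs_mul, abs_of_pos hθ]
    gcongr
  have hsmooth : ∀ u : ℝ, |u| < Real.pi → ContDiffAt ℝ ∞ f (x - θ * u) := fun u hu => by
    refine contDiffAt_of_notMem_singSupp fun hmem => ?_
    have h1 := Metric.infDist_le_dist_of_mem (x := x) hmem
    have h2 := hnear u hu
    rw [Real.dist_eq, abs_sub_comm] at h1
    linarith
  -- The jet consists of the derivatives of `u ↦ f(x - θu)`; the factor `θ^k ≤ 1` preserves the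
  -- radius `r`.
  refine hmain f hper (hf.intervalIntegrable hper) (hf.boundedVariationOn hper _ _) θ x K
    (fun k u => (-θ : ℂ) ^ k * iteratedDeriv k f (x - θ * u)) hθ hθ1 (fun u => by simp) ?_ ?_
    N p hX hp
  · intro k u hu
    have h1 : HasDerivAt (fun u => x - θ * u) (-θ) u := by
      simpa using ((hasDerivAt_id u).const_mul θ).const_sub x
    refine ((((hsmooth u hu).hasDerivAt_iteratedDeriv k).scomp u h1).const_mul
      ((-θ : ℂ) ^ k)).congr_deriv ?_
    rw [Complex.real_smul]
    push_cast
    ring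
  · intro k u hu
    rw [norm_mul, norm_pow, norm_neg, Complex.norm_real, Real.norm_eq_abs, abs_of_pos hθ]
    refine le_trans ?_ (hb _ (hnear u hu) k)
    exact mul_le_of_le_one_left (norm_nonneg _) (pow_le_one₀ hθ.le hθ1)

/-- As `β > 1`, `β log β < 1` forces `log β < 1`, so `β/e = exp(-(1 - log β))` decays; `η` solves
`2√(κη)(1 - log β) = a`. -/
theorem exists_exp_neg_eq_rpow {β κ a : ℝ} (hβ : 1 < β) (hκ : κ = β * Real.log β) (hκ1 : κ < 1)
    (ha : 0 < a) : ∃ η > 0, ∀ X : ℝ, 0 ≤ X →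
      Real.exp (-(a * √X)) = (β / Real.exp 1) ^ (2 * √(κ * η * X)) := by
  have hlog : 0 < Real.log β := Real.log_pos hβ
  have hκ0 : 0 < κ := by rw [hκ]; positivity
  have hL : 0 < 1 - Real.log β := by nlinarith
  refine ⟨(a / (2 * (1 - Real.log β))) ^ 2 / κ, by positivity, fun X _ => ?_⟩
  rw [mul_div_cancel₀ _ hκ0.ne', Real.sqrt_mul (by positivity), Real.sqrt_sq (by positivity)]
  have h1 : β / Real.exp 1 = Real.exp (Real.log β - 1) := by
    rw [Real.exp_sub, Real.exp_log (by linarith)]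
  rw [h1, ← Real.exp_mul]
  congr 1
  field_simp
  ring

end SpectralMollifier

theorem theorem3p1 (c : ℝ) (hc : 0 < c) (β κ : ℝ) (hβ : 1 < β) (hκ : κ = β * Real.log β)
    (hκ_lt : κ < 1) :
    -- for a given `f`, the constants do not depend on `x`, `N`, `p`
    (∀ f : ℝ → ℂ, Function.Periodic f (2 * Real.pi) → IsPiecewiseAnalytic f →
      (singSupp f).Nonempty →
      ∃ η > 0, ∃ ε > 0, ∀ δ > 0, ∀ B : ℝ, ∃ C > 0, ∀ (x : ℝ) (N p : ℕ),
        δ ≤ theta f x * N →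
        |(p : ℝ) - κ * (theta f x * N)| ≤ ε * (theta f x * N) + B →
        ‖recovered c p (theta f x) N f x - f x‖ ≤
          C * (theta f x * N) *
            (β / Real.exp 1) ^ (2 * √(κ * η * (theta f x * N)))) ∧
    -- `η` depends on `f` only through the analyticity radius `r` near `x`, and `C` only through `r`
    -- and, linearly, through the local bound `K` and the total variation of `f` over one period
    (∀ r > 0, ∃ η > 0, ∃ ε > 0, ∀ δ > 0, ∀ B : ℝ, ∃ C > 0, ∀ f : ℝ → ℂ,
      Function.Periodic f (2 * Real.pi) → IsPiecewiseAnalytic f → (singSupp f).Nonempty →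
      ∀ (x K : ℝ),
        (∀ y : ℝ, |y - x| < Metric.infDist x (singSupp f) →
          ∀ s : ℕ, ‖iteratedDeriv s f y‖ ≤ K * s.factorial / r ^ s) →
      ∀ N p : ℕ,
        δ ≤ theta f x * N →
        |(p : ℝ) - κ * (theta f x * N)| ≤ ε * (theta f x * N) + B →
        ‖recovered c p (theta f x) N f x - f x‖ ≤
          C * (K + (eVariationOn f (Set.Icc 0 (2 * Real.pi))).toReal) * (theta f x * N) *
            (β / Real.exp 1) ^ (2 * √(κ * η * (theta f x * N)))) := by
  have hκ0 : 0 < κ := by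
    have := Real.log_pos hβ
    rw [hκ]
    positivity
  -- The uniform statement implies the one for fixed `f`.
  rw [and_iff_right_of_imp]
  · intro r hr
    obtain ⟨a, ha, ε, hε, h⟩ := exists_norm_recovered_theta_sub_le hc hκ0 hκ_lt hr
    obtain ⟨η, hη, hexp⟩ := exists_exp_neg_eq_rpow hβ hκ hκ_lt ha
    refine ⟨η, hη, ε, hε, fun δ hδ B => ?_⟩
    obtain ⟨C, hC, h⟩ := h δ hδ B
    refine ⟨C, hC, fun f hper hf hne x K hb N p hX hp => ?_⟩
    rw [← hexp _ (hδ.le.trans hX)]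
    exact h f hper hf hne x K hb N p hX hp
  · intro hunif f hper hf hne
    obtain ⟨K, hK, r, hr, hb⟩ := hf.hasCauchyBoundOn hper
    obtain ⟨η, hη, ε, hε, h⟩ := hunif r hr
    refine ⟨η, hη, ε, hε, fun δ hδ B => ?_⟩
    obtain ⟨C, hC, h⟩ := h δ hδ B
    -- The `+ 1` keeps the constant positive when `K` and the variation vanish.
    refine ⟨C * (K + (eVariationOn f (Set.Icc 0 (2 * Real.pi))).toReal) + 1, by positivity,
      fun x N p hX hp => ?_⟩
    have hX0 : 0 ≤ theta f x * N := hδ.le.trans hX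
    refine (h f hper hf hne x K (fun y hy => hb y fun hmem => ?_) N p hX hp).trans ?_
    · have := Metric.infDist_le_dist_of_mem (x := x) hmem
      rw [Real.dist_eq, abs_sub_comm] at this
      linarith
    · have : 0 ≤ β := by linarith
      gcongr
      linarith
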